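/- Consider a planar cellular network with path-loss exponent $\eta>2$. Base stations (BSs) form a homogeneous Poisson point process (PPP) of density $\lambda>0$; devices form a homogeneous PPP of density $\mu>0$; let $\alpha=\mu/\lambda$. Under Random-Based Clustering each device independently becomes a cluster head (CH) with probability $\delta\in(0,1]$, and each CH picks one of $n_Z\ge 1$ Zadoff–Chu codes uniformly at random. Each CH transmits with power $\rho_L R^{\eta}$ (full path-loss inversion, $\rho_L>0$), where $R$ is the distance to its serving (nearest) BS. All channel power gains are independent and exponentially distributed with mean $1$. The test CH, served by a BS at the origin, succeeds if $$\frac{\rho_L h_\circ}{\sigma^2+\mathcal I_{\rm In}+\mathcal I_{\rm Out}}>\theta ,\qquad \theta>0,$$ where $h_\circ$ is its channel gain, $\sigma^2\ge 0$ is the noise power and: - $\mathcal I_{\rm Out}=\sum_m P_m h_m \|x_m\|^{-\eta}$, the sum running over the CHs $x_m$ of the device PPP that use the code of the test CH and satisfy $P_m\|x_m\|^{-\eta}<\rho_L$; spatial correlations of transmit powers are ignored, that is, the powers $P_m=\rho_L R_m^{\eta}$ are independent of each other and of everything else, each $R_m$ being distributed as the distance from a point to the nearest BS; - $\mathcal I_{\rm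 In}=\sum_{i=1}^{\mathcal N}\rho_L h'_i$, where the number $\mathcal N$ of intra-cell interferers, independent of everything else, follows the law obtained from the gamma approximation of the area of a Poisson–Voronoi cell: with $c=3.575$ and $\kappa=\delta\mu/n_Z$, $$\mathbb P\{\mathcal N=n\}=\frac{\Gamma(n+c)}{\Gamma(n+1)\Gamma(c)}\,\frac{\kappa^{n}(\lambda c)^{c}}{(\kappa+\lambda c)^{n+c}},\qquad n=0,1,2,\dots$$ All these random quantities (device locations, CH indicators, codes, service distances, channel gains, $\mathcal N$) are mutually independent. Then in this (approximate) model the random access success probability is exactly $$P_{\rm RA}=\frac{\exp\left\{-\frac{\sigma^2\theta}{\rho_L}-\frac{2\delta\alpha\theta}{n_Z(\eta-2)}\;{}_2F_1\!\left(1,1-\tfrac2\eta;2-\tfrac2\eta;-\theta\right)\right\}}{\left(1+\frac{\delta\alpha\theta}{n_Z(1+\theta)c}\right)^{c}},$$ where ${}_2F_1$ is the Gauss hypergeometric function (analytically continued to $(-\infty,1)$). For $\eta=4$, $$P_{\rm RA}=\frac{\exp\left\{-\frac{\sigma^2\theta}{\rho_L}-\frac{\delta\alpha}{n_Z}\sqrt{\theta}\,\arctan\sqrt{\theta}\right\}}{\left(1+\frac{\delta\alpha\theta}{n_Z(1+\theta)c}\right)^{c}}.$$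 -/

import Mathlib

open MeasureTheory ProbabilityTheory Set Filter Topology

noncomputable section

/-- The Euclidean plane. -/
abbrev Plane : Type := EuclideanSpace ℝ (Fin 2)

/-- Number of points of the enumerated point process `X` that lie in `B`. -/
def pointCount {Ω E : Type*} (X : ℕ → Ω → E) (B : Set E) (ω : Ω) : ENNReal :=
  ∑' i, B.indicator (fun _ => (1 : ENNReal)) (X i ω)

/-- `X` enumerates a Poisson point process with (infinite) intensity measure `Λ`:
the number of points in a set of finite intensity is Poisson distributed, and the numbers of
points in pairwise disjoint sets are independent. -/
structure IsPoissonProcess {Ω E : Type*} [MeasurableSpace Ω] [MeasurableSpace E]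
    (X : ℕ → Ω → E) (Λ : Measure E) (P : Measure Ω) : Prop where
  measurable : ∀ i, Measurable (X i)
  law_count : ∀ B : Set E, MeasurableSet B → Λ B ≠ ⊤ → ∀ n : ℕ,
    P {ω | pointCount X B ω = n} = poissonMeasure (Λ B).toNNReal {n}
  indep_count : ∀ (k : ℕ) (B : Fin k → Set E), (∀ j, MeasurableSet (B j)) →
    Pairwise (fun i j => Disjoint (B i) (B j)) → iIndepFun (fun j => pointCount X (B j)) P

/-- `X` enumerates a homogeneous Poisson point process of density `d` in the plane. -/
def IsHomogeneousPPP {Ω : Type*} [MeasurableSpace Ω] (X : ℕ → Ω → Plane) (d : ℝ)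
    (P : Measure Ω) : Prop :=
  IsPoissonProcess X (ENNReal.ofReal d • (volume : Measure Plane)) P

/-- Distance from the location `x` to the nearest point of the process `Y`. -/
def nearestDist {Ω : Type*} (Y : ℕ → Ω → Plane) (x : Plane) (ω : Ω) : ℝ :=
  Metric.infDist x (range fun i => Y i ω)

/-- The Gauss hypergeometric function `₂F₁(a, b; c; x)` for real `x < 1`: the analytic
continuation to `(-∞, 1)` of the hypergeometric series, unique by the identity theorem.
(The series itself converges only for `|x| < 1`.) -/
def gaussHypergeometric (a b c x : ℝ) : ℝ :=
  Classical.epsilon (fun F : ℝ → ℝ => AnalyticOnNhd ℝ F (Iio 1) ∧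
    ∀ᶠ z in 𝓝 (0 : ℝ), F z = ordinaryHypergeometric a b c z) x

/-- The constant of the gamma approximation of the planar Poisson-Voronoi cell area. -/
def voronoiConst : ℝ := 3.575

/-- Probability that `n` points of a process of density `κ` lie in a Voronoi cell of a Poisson
process of density `lam`, under the gamma approximation of the cell area. -/
def voronoiCountPMF (κ lam : ℝ) (n : ℕ) : ℝ :=
  Real.Gamma (n + voronoiConst) / (Real.Gamma (n + 1) * Real.Gamma voronoiConst) *
    (κ ^ n * (lam * voronoiConst) ^ voronoiConst /
      (κ + lam * voronoiConst) ^ ((n : ℝ) + voronoiConst))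

/-- The random quantities seen by the base station (BS), located at the origin, that serves the
test cluster head (CH). Devices are indexed by `ℕ`. -/
structure RandomAccess (Ω : Type*) (nZ : ℕ) where
  /-- device locations -/
  pos : ℕ → Ω → Plane
  /-- whether the device is a CH -/
  isCH : ℕ → Ω → Bool
  /-- the Zadoff-Chu code the device picks if it is a CH -/
  code : ℕ → Ω → Fin nZ
  /-- distance of the device to its own serving BS -/
  servDist : ℕ → Ω → ℝ
  /-- power gain of the channel from the device to the BS at the origin -/
  gain : ℕ → Ω → ℝ
  /-- power gain of the channel of the test CH -/
  testGain : Ω → ℝ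
  /-- number of intra-cell interferers on the code of the test CH -/
  neighbours : Ω → ℕ
  /-- power gains of the channels of the intra-cell interferers -/
  intraGain : ℕ → Ω → ℝ

/-- Labels of the sources of randomness. -/
inductive RandomSource where
  | pos
  | isCH (m : ℕ)
  | code (m : ℕ)
  | servDist (m : ℕ)
  | gain (m : ℕ)
  | testGain
  | neighbours
  | intraGain (i : ℕ)

namespace RandomAccess

variable {Ω : Type*} {nZ : ℕ}

/-- The sigma-algebra generated by a source of randomness. All device locations together form one
source. -/
@[reducible] def sigma (S : RandomAccess Ω nZ) : RandomSource → MeasurableSpace Ω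
  | .pos => ⨆ m, MeasurableSpace.comap (S.pos m) inferInstance
  | .isCH m => MeasurableSpace.comap (S.isCH m) inferInstance
  | .code m => MeasurableSpace.comap (S.code m) inferInstance
  | .servDist m => MeasurableSpace.comap (S.servDist m) inferInstance
  | .gain m => MeasurableSpace.comap (S.gain m) inferInstance
  | .testGain => MeasurableSpace.comap S.testGain inferInstance
  | .neighbours => MeasurableSpace.comap S.neighbours inferInstance
  | .intraGain i => MeasurableSpace.comap (S.intraGain i) inferInstance

/-- Transmit power of device `m` under full path-loss inversion with target level `ρ`. -/
def power (S : RandomAccess Ω nZ) (ρ η : ℝ) (m : ℕ) (ω : Ω) : ℝ :=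
  ρ * S.servDist m ω ^ η

/-- Devices that interfere from other cells with a test CH using code `z`: the CHs on code `z`
whose average received power at the BS at the origin is below `ρ` (that is, which are closer to
their own serving BS). -/
def interCell (S : RandomAccess Ω nZ) (z : Fin nZ) (ρ η : ℝ) (ω : Ω) : Set ℕ :=
  {m | S.isCH m ω = true ∧ S.code m ω = z ∧ S.power ρ η m ω * ‖S.pos m ω‖ ^ (-η) < ρ}

/-- Inter-cell interference. -/
def interInterference (S : RandomAccess Ω nZ) (z : Fin nZ) (ρ η : ℝ) (ω : Ω) : ENNReal :=
  ∑' m, (S.interCell z ρ η ω).indicator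
    (fun m => ENNReal.ofReal (S.power ρ η m ω * S.gain m ω * ‖S.pos m ω‖ ^ (-η))) m

/-- Intra-cell interference: path-loss inversion makes the average received power of each
intra-cell interferer equal to `ρ`. -/
def intraInterference (S : RandomAccess Ω nZ) (ρ : ℝ) (ω : Ω) : ENNReal :=
  ∑ i ∈ Finset.range (S.neighbours ω), ENNReal.ofReal (ρ * S.intraGain i ω)

/-- Signal to interference and noise ratio of the test CH, with noise power `σ ^ 2`. -/
def sinr (S : RandomAccess Ω nZ) (z : Fin nZ) (ρ η σ : ℝ) (ω : Ω) : ENNReal :=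
  ENNReal.ofReal (ρ * S.testGain ω) /
    (ENNReal.ofReal (σ ^ 2) + S.intraInterference ρ ω + S.interInterference z ρ η ω)

/-- The random access success probability: the SINR exceeds the threshold `θ`. -/
def successProb [MeasurableSpace Ω] (S : RandomAccess Ω nZ) (P : Measure Ω) (z : Fin nZ)
    (ρ η σ θ : ℝ) : ℝ :=
  P.real {ω | ENNReal.ofReal θ < S.sinr z ρ η σ ω}

/-- Random-Based Clustering with device density `mu`, CH selection probability `δ` and base
stations forming a Poisson process `bs` of density `lam`, in the approximation that ignores spatial
correlations: service distances of different devices are independent, each having the law of the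
distance to the nearest BS, and the number of intra-cell interferers, independent of everything
else, has the law derived from the gamma approximation of the Voronoi cell area. -/
structure IsRBC [MeasurableSpace Ω] (S : RandomAccess Ω nZ) (P : Measure Ω)
    {Ω' : Type*} [MeasurableSpace Ω'] (bs : ℕ → Ω' → Plane) (Q : Measure Ω')
    (lam mu δ : ℝ) : Prop where
  bs_ppp : IsHomogeneousPPP bs lam Q
  pos_ppp : IsHomogeneousPPP S.pos mu P
  measurable_isCH : ∀ m, Measurable (S.isCH m)
  prob_isCH : ∀ m, P {ω | S.isCH m ω = true} = ENNReal.ofReal δ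
  measurable_code : ∀ m, Measurable (S.code m)
  prob_code : ∀ m z, P {ω | S.code m ω = z} = (nZ : ENNReal)⁻¹
  measurable_servDist : ∀ m, Measurable (S.servDist m)
  law_servDist : ∀ m, IdentDistrib (S.servDist m) (nearestDist bs 0) P Q
  measurable_gain : ∀ m, Measurable (S.gain m)
  law_gain : ∀ m, P.map (S.gain m) = expMeasure 1
  measurable_testGain : Measurable S.testGain
  law_testGain : P.map S.testGain = expMeasure 1
  measurable_neighbours : Measurable S.neighbours
  prob_neighbours : ∀ n : ℕ,
    P {ω | S.neighbours ω = n} = ENNReal.ofReal (voronoiCountPMF (δ * mu / nZ) lam n)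
  measurable_intraGain : ∀ i, Measurable (S.intraGain i)
  law_intraGain : ∀ i, P.map (S.intraGain i) = expMeasure 1
  indep : iIndep S.sigma P

end RandomAccess

end

/-! The channel gain of the test CH is exponential, so conditionally on the denominator `D` of the
SINR success has probability `exp (-θ D / ρ)`. Noise, intra-cell and inter-cell interference are
independent, so the success probability is a product of three Laplace transforms at `θ / ρ`
(`measure_success`). All interference is kept in `[0, ∞]`, with `expNeg` sending `⊤` to `0`, so no
sum has to be shown finite.

Intra-cell: every interferer contributes the factor `1 / (1 + θ)`, so the transform is the
generating function of the number of interferers at that point, a binomial series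
(`hasSum_voronoiCountPMF_mul_pow`).

Inter-cell: the marks of the devices are averaged out one at a time (`lintegral_expNeg_tsum_marks`),
which leaves a functional of the positions alone. The Poisson Laplace functional
(`IsPoissonProcess.lintegral_expNeg_tsum`) then gives `exp (-∫ L)`, where `L x` is the mean of `1 -
exp (-θ I / ρ)` for a device at `x` with interference `I`. In polar coordinates, scaled by the
service distance `R`, the spatial integral is `2π K R²` with `K = ∫_1^∞ θ u^(1-η) / (1 + θ u^(-η))
du`. Since `E R² = 1 / (π λ)`, the exponent is `2 δ α K / n_Z`.

Finally `K` is evaluated. In general it is an average of Cauchy kernels `1 / (1 - x T)` with `T ∈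
[0, 1]`, hence analytic in `x < 1`, and its series at `0` is hypergeometric
(`gaussHypergeometric_eq_integral`). For `η = 4` it has an arctangent primitive. -/

noncomputable section

/-! ### The exponential kernel on `[0, ∞]`. -/

/-- The function `x ↦ exp (-x)` on `[0, ∞]`. -/
def expNeg (x : ENNReal) : ENNReal := EReal.exp (-(x : EReal))

@[simp] lemma expNeg_zero : expNeg 0 = 1 := by simp [expNeg]

@[simp] lemma expNeg_top : expNeg ⊤ = 0 := by simp [expNeg]

lemma expNeg_ofReal {r : ℝ} (hr : 0 ≤ r) :
    expNeg (ENNReal.ofReal r) = ENNReal.ofReal (Real.exp (-r)) := by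
  rw [expNeg, EReal.coe_ennreal_ofReal, max_eq_left hr, ← EReal.coe_neg, EReal.exp_coe]

lemma expNeg_antitone : Antitone expNeg := fun x y h => by
  unfold expNeg
  exact EReal.exp_monotone (EReal.neg_le_neg_iff.2 (by exact_mod_cast h))

lemma expNeg_le_one (x : ENNReal) : expNeg x ≤ 1 := by
  simpa using expNeg_antitone (zero_le (a := x))

lemma expNeg_ne_top (x : ENNReal) : expNeg x ≠ ⊤ :=
  ((expNeg_le_one x).trans_lt ENNReal.one_lt_top).ne

lemma continuous_expNeg : Continuous expNeg :=
  ENNReal.continuous_exp.comp (continuous_neg.comp continuous_coe_ennreal_ereal)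

lemma measurable_expNeg : Measurable expNeg := continuous_expNeg.measurable

lemma expNeg_add (x y : ENNReal) : expNeg (x + y) = expNeg x * expNeg y := by
  rw [expNeg, EReal.coe_ennreal_add, EReal.neg_add (by simp) (by simp), sub_eq_add_neg,
    EReal.exp_add, expNeg, expNeg]

lemma expNeg_sum {ι : Type*} (s : Finset ι) (f : ι → ENNReal) :
    expNeg (∑ i ∈ s, f i) = ∏ i ∈ s, expNeg (f i) := by
  classical
  induction s using Finset.induction_on with
  | empty => simp
  | insert a s ha ih => rw [Finset.sum_insert ha, Finset.prod_insert ha, expNeg_add, ih]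

lemma expNeg_mul_natCast (x : ENNReal) (n : ℕ) : expNeg (x * n) = expNeg x ^ n := by
  have := expNeg_sum (Finset.range n) (fun _ => x)
  simpa [mul_comm] using this

/-- The extended logarithm inverts the extended exponential, also at `y = 0`, where the exponent is
`⊤`. This is how an averaged factor is written again as `expNeg` of a function. -/
lemma exists_expNeg_eq {y : ENNReal} (hy : y ≤ 1) : expNeg (-(ENNReal.log y)).toENNReal = y := by
  have h : ENNReal.log y ≤ 0 := by
    rw [← ENNReal.log_one]; exact ENNReal.log_monotone hy
  rw [expNeg, EReal.coe_toENNReal (by rw [← neg_zero]; exact EReal.neg_le_neg_iff.2 h), neg_neg,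
    ENNReal.exp_log]

/-- The constant `1` dominates and the measure is finite, so pointwise convergence is enough, even
towards `⊤`. -/
lemma tendsto_lintegral_expNeg {α : Type*} [MeasurableSpace α] {μ : Measure α}
    [IsFiniteMeasure μ] {f : ℕ → α → ENNReal} {g : α → ENNReal} (hf : ∀ n, Measurable (f n))
    (h : ∀ a, Tendsto (fun n => f n a) atTop (𝓝 (g a))) :
    Tendsto (fun n => ∫⁻ a, expNeg (f n a) ∂μ) atTop (𝓝 (∫⁻ a, expNeg (g a) ∂μ)) := by
  refine tendsto_lintegral_of_dominated_convergence (fun _ => 1)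
    (fun n => measurable_expNeg.comp (hf n))
    (fun n => ae_of_all _ fun a => expNeg_le_one _) (by simp) (ae_of_all _ fun a => ?_)
  exact (continuous_expNeg.tendsto _).comp (h a)

/-! ### Laplace functional of a Poisson process. -/

section PoissonProcess

variable {Ω E : Type*} [MeasurableSpace Ω] [MeasurableSpace E]

/-- Laplace transform of a Poisson variable with values in `[0, ∞]`. -/
lemma lintegral_expNeg_poisson {P : Measure Ω} [IsProbabilityMeasure P] {N : Ω → ENNReal}
    (hN : Measurable N) {r : NNReal}
    (hlaw : ∀ n : ℕ, P {ω | N ω = n} = poissonMeasure r {n}) (c : ENNReal) :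
    ∫⁻ ω, expNeg (c * N ω) ∂P = expNeg (r * (1 - expNeg c)) := by
  have hmeas : ∀ n : ℕ, MeasurableSet {ω | N ω = n} := fun n => hN (measurableSet_singleton _)
  have hdisj : Pairwise (fun i j : ℕ => Disjoint {ω | N ω = i} {ω | N ω = j}) := by
    intro i j hij
    refine Set.disjoint_left.2 fun ω h1 h2 => hij ?_
    have : (i : ENNReal) = j := h1.symm.trans h2
    exact_mod_cast this
  obtain ⟨y, hy, hy1, hyc⟩ : ∃ y : ℝ, 0 ≤ y ∧ y ≤ 1 ∧ expNeg c = ENNReal.ofReal y :=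
    ⟨(expNeg c).toReal, ENNReal.toReal_nonneg,
      by simpa using ENNReal.toReal_mono ENNReal.one_ne_top (expNeg_le_one c),
      (ENNReal.ofReal_toReal (expNeg_ne_top c)).symm⟩
  -- The law is prescribed only at natural numbers; because these probabilities already sum to one,
  -- every other value in `[0, ∞]` has probability zero.
  have hsum1 : P (⋃ n : ℕ, {ω | N ω = n}) = 1 := by
    rw [measure_iUnion hdisj hmeas]
    simp_rw [hlaw, poissonMeasure_singleton]
    rw [← ENNReal.ofReal_tsum_of_nonneg (fun n => by positivity)
      (hasSum_one_poissonMeasure r).summable, (hasSum_one_poissonMeasure r).tsum_eq,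
      ENNReal.ofReal_one]
  have hae : ∀ᵐ ω ∂P, ω ∈ ⋃ n : ℕ, {ω | N ω = n} := by
    rw [ae_iff]
    exact (prob_compl_eq_zero_iff (MeasurableSet.iUnion hmeas)).2 hsum1
  rw [← Measure.restrict_eq_self_of_ae_mem hae, lintegral_iUnion hmeas hdisj]
  have hterm : ∀ n : ℕ, ∫⁻ ω in {ω | N ω = n}, expNeg (c * N ω) ∂P
      = ENNReal.ofReal (Real.exp (-r) * ((r * y) ^ n / n.factorial)) := by
    intro n
    rw [setLIntegral_congr_fun (g := fun _ => expNeg c ^ n) (hmeas n)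
      (fun ω hω => by
        have : N ω = n := hω
        simp only [this, expNeg_mul_natCast]),
      setLIntegral_const, hlaw, poissonMeasure_singleton, hyc, ← ENNReal.ofReal_pow hy,
      ← ENNReal.ofReal_mul (by positivity)]
    congr 1
    rw [mul_pow]; ring
  simp_rw [hterm]
  have hs : HasSum (fun n : ℕ => Real.exp (-r) * ((r * y) ^ n / n.factorial))
      (Real.exp (-r) * Real.exp (r * y)) := by
    refine HasSum.mul_left _ ?_
    rw [Real.exp_eq_exp_ℝ]
    exact NormedSpace.expSeries_div_hasSum_exp (r * y)
  rw [← ENNReal.ofReal_tsum_of_nonneg (fun n => by positivity) hs.summable, hs.tsum_eq, hyc,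
    ← ENNReal.ofReal_one, ← ENNReal.ofReal_sub _ hy, ← ENNReal.ofReal_coe_nnreal,
    ← ENNReal.ofReal_mul r.coe_nonneg, expNeg_ofReal (mul_nonneg r.coe_nonneg (by linarith)), ← Real.exp_add]
  congr 2; ring

lemma measurable_pointCount {X : ℕ → Ω → E} (hX : ∀ i, Measurable (X i)) {B : Set E}
    (hB : MeasurableSet B) : Measurable (pointCount X B) := by
  unfold pointCount
  exact Measurable.tsum fun i => (measurable_const.indicator hB).comp (hX i)

/-- A simple function splits the sum into multiples of the counts of its disjoint level sets; these
counts are independent and Poisson. -/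
lemma IsPoissonProcess.lintegral_expNeg_simpleFunc {P : Measure Ω} [IsProbabilityMeasure P]
    {X : ℕ → Ω → E} {Λ : Measure E} (h : IsPoissonProcess X Λ P) (f : SimpleFunc E ENNReal)
    (hf : ∀ c ≠ 0, Λ (f ⁻¹' {c}) ≠ ⊤) :
    ∫⁻ ω, expNeg (∑' i, f (X i ω)) ∂P = expNeg (∫⁻ x, (1 - expNeg (f x)) ∂Λ) := by
  -- The zero level set may have infinite intensity, where the count law says nothing. It
  -- contributes to neither side and is dropped.
  set s : Finset ENNReal := f.range.filter (· ≠ 0)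
  have hcount : ∀ ω, ∑' i, f (X i ω) = ∑ c ∈ s, c * pointCount X (f ⁻¹' {c}) ω := by
    intro ω
    unfold pointCount
    rw [Finset.sum_congr rfl fun c _ => ENNReal.tsum_mul_left.symm,
      ← Summable.tsum_finsetSum (fun _ _ => ENNReal.summable)]
    congr 1; funext i
    have : ∀ c, c * (f ⁻¹' {c}).indicator (fun _ => (1 : ENNReal)) (X i ω)
        = if f (X i ω) = c then c else 0 := by
      intro c
      by_cases hc : f (X i ω) = c
      · rw [Set.indicator_of_mem (show X i ω ∈ f ⁻¹' {c} from hc), if_pos hc, mul_one]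
      · rw [Set.indicator_of_notMem (show X i ω ∉ f ⁻¹' {c} from hc), if_neg hc, mul_zero]
    rw [Finset.sum_congr rfl fun c _ => this c]
    rw [Finset.sum_ite_eq]
    by_cases h0 : f (X i ω) = 0
    · simp [s, h0]
    · simp [s, h0]
  have hmeas : ∀ c, MeasurableSet (f ⁻¹' {c}) := fun c => f.measurableSet_fiber c
  have hind : iIndepFun (fun c : s => pointCount X (f ⁻¹' {(c : ENNReal)})) P := by
    have hi := h.indep_count s.card (fun j => f ⁻¹' {((s.equivFin.symm j : s) : ENNReal)})
      (fun j => hmeas _) (fun i j hij => ?_)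
    · have := hi.precomp (g := s.equivFin) s.equivFin.injective
      simpa using this
    · refine Set.disjoint_left.2 fun x h1 h2 => hij ?_
      have h3 : ((s.equivFin.symm i : s) : ENNReal) = s.equivFin.symm j := by
        have h1' : f x = _ := h1
        have h2' : f x = _ := h2
        exact h1'.symm.trans h2'
      exact s.equivFin.symm.injective (Subtype.ext h3)
  calc ∫⁻ ω, expNeg (∑' i, f (X i ω)) ∂P
      = ∫⁻ ω, ∏ c : s, expNeg (c * pointCount X (f ⁻¹' {(c : ENNReal)}) ω) ∂P := by
        refine lintegral_congr fun ω => ?_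
        rw [hcount, expNeg_sum, ← Finset.prod_coe_sort]
    _ = ∏ c : s, ∫⁻ ω, expNeg (c * pointCount X (f ⁻¹' {(c : ENNReal)}) ω) ∂P := by
        refine lintegral_prod_eq_prod_lintegral_of_indepFun Finset.univ
          (fun (c : s) ω => expNeg (c * pointCount X (f ⁻¹' {(c : ENNReal)}) ω)) ?_ ?_
        · exact hind.comp (fun c x => expNeg (c * x))
            (fun c => measurable_expNeg.comp (measurable_const.mul measurable_id))
        · exact fun c => measurable_expNeg.comp
            (measurable_const.mul (measurable_pointCount h.measurable (hmeas _)))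
    _ = ∏ c : s, expNeg (Λ (f ⁻¹' {(c : ENNReal)}) * (1 - expNeg c)) := by
        refine Finset.prod_congr rfl fun c _ => ?_
        have hc : (c : ENNReal) ≠ 0 := (Finset.mem_filter.1 c.2).2
        rw [lintegral_expNeg_poisson (measurable_pointCount h.measurable (hmeas _))
          (h.law_count _ (hmeas _) (hf _ hc)), ENNReal.coe_toNNReal (hf _ hc)]
    _ = expNeg (∑ c ∈ s, (1 - expNeg c) * Λ (f ⁻¹' {c})) := by
        rw [expNeg_sum, ← Finset.prod_coe_sort s]
        exact Finset.prod_congr rfl fun c _ => by rw [mul_comm]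
    _ = expNeg (∫⁻ x, (1 - expNeg (f x)) ∂Λ) := by
        congr 1
        have := SimpleFunc.map_lintegral (μ := Λ) (fun c => 1 - expNeg c) f
        rw [← SimpleFunc.lintegral_eq_lintegral] at this
        simp only [SimpleFunc.map_apply] at this
        rw [this, Finset.sum_filter]
        refine Finset.sum_congr rfl fun c _ => ?_
        by_cases h0 : c = 0 <;> simp [h0]

/-- The Laplace functional of a Poisson point process. -/
theorem IsPoissonProcess.lintegral_expNeg_tsum {P : Measure Ω} [IsProbabilityMeasure P]
    {X : ℕ → Ω → E} {Λ : Measure E} [SigmaFinite Λ] (h : IsPoissonProcess X Λ P)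
    {f : E → ENNReal} (hf : Measurable f) :
    ∫⁻ ω, expNeg (∑' i, f (X i ω)) ∂P = expNeg (∫⁻ x, (1 - expNeg (f x)) ∂Λ) := by
  -- Cutting off to sets of finite intensity makes every nonzero level set finite, as the
  -- simple-function case requires.
  set g : ℕ → SimpleFunc E ENNReal := fun n =>
    (SimpleFunc.eapprox f n).restrict (spanningSets Λ n)
  have hg_apply : ∀ n x, g n x = (spanningSets Λ n).indicator (SimpleFunc.eapprox f n) x :=
    fun n x => SimpleFunc.restrict_apply _ (measurableSet_spanningSets Λ n) x
  have hg_mono : ∀ x, Monotone fun n => g n x := by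
    intro x m n hmn
    simp only [hg_apply]
    refine Set.indicator_le_indicator_of_subset (monotone_spanningSets Λ hmn)
      (fun _ => zero_le) x |>.trans ?_
    exact Set.indicator_le_indicator (SimpleFunc.monotone_eapprox f hmn x)
  have hg_tend : ∀ x, Tendsto (fun n => g n x) atTop (𝓝 (f x)) := by
    intro x
    refine (SimpleFunc.tendsto_eapprox hf x).congr' ?_
    filter_upwards [eventually_ge_atTop (spanningSetsIndex Λ x)] with n hn
    rw [hg_apply, Set.indicator_of_mem (mem_spanningSets_of_index_le Λ x hn)]
  have hg_sup : ∀ x, ⨆ n, g n x = f x := fun x =>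
    tendsto_nhds_unique (tendsto_atTop_iSup (hg_mono x)) (hg_tend x)
  have hsimple : ∀ n, ∫⁻ ω, expNeg (∑' i, g n (X i ω)) ∂P
      = expNeg (∫⁻ x, (1 - expNeg (g n x)) ∂Λ) := by
    refine fun n => h.lintegral_expNeg_simpleFunc (g n) fun c hc => ?_
    refine ((measure_mono ?_).trans_lt (measure_spanningSets_lt_top Λ n)).ne
    intro x hx
    by_contra hxn
    have h1 : g n x = c := hx
    rw [hg_apply, Set.indicator_of_notMem hxn] at h1
    exact hc h1.symm
  have hleft : Tendsto (fun n => ∫⁻ ω, expNeg (∑' i, g n (X i ω)) ∂P) atTop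
      (𝓝 (∫⁻ ω, expNeg (∑' i, f (X i ω)) ∂P)) := by
    refine tendsto_lintegral_expNeg (fun n => Measurable.tsum fun i =>
      (g n).measurable.comp (h.measurable i)) fun ω => ?_
    have hm : Monotone fun n => ∑' i, g n (X i ω) := fun m n hmn =>
      ENNReal.tsum_le_tsum fun i => hg_mono _ hmn
    have := tendsto_atTop_iSup hm
    -- Monotone convergence for the counting measure moves the supremum inside the sum over points.
    have hc := lintegral_iSup (μ := Measure.count) (f := fun n i => g n (X i ω))
      (fun n => measurable_of_countable _) (fun m n hmn i => hg_mono _ hmn)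
    simp only [lintegral_count, hg_sup] at hc
    rwa [← hc] at this
  have hright : Tendsto (fun n => expNeg (∫⁻ x, (1 - expNeg (g n x)) ∂Λ)) atTop
      (𝓝 (expNeg (∫⁻ x, (1 - expNeg (f x)) ∂Λ))) := by
    refine (continuous_expNeg.tendsto _).comp ?_
    refine lintegral_tendsto_of_tendsto_of_monotone
      (fun n => (measurable_const.sub (measurable_expNeg.comp (g n).measurable)).aemeasurable)
      (ae_of_all _ fun x m n hmn => ?_) (ae_of_all _ fun x => ?_)
    · exact tsub_le_tsub_left (expNeg_antitone (hg_mono x hmn)) _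
    · exact ENNReal.Tendsto.sub tendsto_const_nhds
        ((continuous_expNeg.tendsto _).comp (hg_tend x)) (Or.inl ENNReal.one_ne_top)
  exact tendsto_nhds_unique hleft (by simpa only [hsimple] using hright)

end PoissonProcess

/-! ### Integrating out independent variables and marks. -/

section Independence

variable {Ω A B E : Type*} [MeasurableSpace A] [MeasurableSpace B]
  [MeasurableSpace E]

/-- Integrating out one of two independent variables. -/
lemma lintegral_eq_lintegral_lintegral_of_indep {mF mG : MeasurableSpace Ω}
    [mΩ : MeasurableSpace Ω] {P : Measure Ω} [IsProbabilityMeasure P] (hF : mF ≤ mΩ) (hG : mG ≤ mΩ) (h : Indep mF mG P)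
    {Z : Ω → A} (hZ : Measurable[mF] Z) {U : Ω → B} (hU : Measurable[mG] U)
    {f : A × B → ENNReal} (hf : Measurable f) :
    ∫⁻ ω, f (Z ω, U ω) ∂P = ∫⁻ ω, ∫⁻ ω', f (Z ω, U ω') ∂P ∂P := by
  have hZ' : Measurable Z := hZ.mono hF le_rfl
  have hU' : Measurable U := hU.mono hG le_rfl
  have hi : IndepFun Z U P :=
    indep_of_indep_of_le_left (indep_of_indep_of_le_right h (measurable_iff_comap_le.1 hU))
      (measurable_iff_comap_le.1 hZ)
  have := Measure.isProbabilityMeasure_map (μ := P) hU'.aemeasurable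
  have := Measure.isProbabilityMeasure_map (μ := P) hZ'.aemeasurable
  rw [← lintegral_map hf (hZ'.prodMk hU'),
    (indepFun_iff_map_prod_eq_prod_map_map hZ'.aemeasurable hU'.aemeasurable).1 hi,
    lintegral_prod _ hf.aemeasurable, lintegral_map hf.lintegral_prod_right' hZ']
  refine lintegral_congr fun ω => ?_
  exact lintegral_map (hf.comp measurable_prodMk_left) hU'

/-- Independent marks of a point process can be averaged out of a Laplace functional. -/
lemma lintegral_expNeg_tsum_marks {m₀ : MeasurableSpace Ω} {mk mF : ℕ → MeasurableSpace Ω}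
    [mΩ : MeasurableSpace Ω] {P : Measure Ω} [IsProbabilityMeasure P]
    (hmk : ∀ n, mk n ≤ mΩ) (hmF : ∀ n, mF n ≤ mΩ) (h₀ : ∀ n, m₀ ≤ mF n)
    (hlt : ∀ n j, j < n → mk j ≤ mF n) (hind : ∀ n, Indep (mF n) (mk n) P)
    {X : ℕ → Ω → E} (hX : ∀ n, Measurable[m₀] (X n)) {U : ℕ → Ω → B}
    (hU : ∀ n, Measurable[mk n] (U n)) {ψ : E × B → ENNReal} (hψ : Measurable ψ)
    {f : E → ENNReal} (hf : Measurable f)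
    (hfψ : ∀ n x, ∫⁻ ω, expNeg (ψ (x, U n ω)) ∂P = expNeg (f x)) :
    ∫⁻ ω, expNeg (∑' n, ψ (X n ω, U n ω)) ∂P = ∫⁻ ω, expNeg (∑' n, f (X n ω)) ∂P := by
  -- The induction needs an arbitrary `W`: integrating out mark `k` turns its factor into `expNeg (f
  -- (X k))`, which is `m₀`-measurable, so `f (X k)` is absorbed in `W` before the induction
  -- hypothesis is used.
  have key : ∀ k, ∀ W : Ω → ENNReal, Measurable[m₀] W →
      ∫⁻ ω, expNeg (W ω + ∑ n ∈ Finset.range k, ψ (X n ω, U n ω)) ∂P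
        = ∫⁻ ω, expNeg (W ω + ∑ n ∈ Finset.range k, f (X n ω)) ∂P := by
    intro k
    induction k with
    | zero => intro W _; simp
    | succ k ih =>
      intro W hW
      have hZ : Measurable[mF k]
          (fun ω => (W ω + ∑ n ∈ Finset.range k, ψ (X n ω, U n ω), X k ω)) := by
        refine Measurable.prodMk ?_ ((hX k).mono (h₀ k) le_rfl)
        refine Measurable.add (hW.mono (h₀ k) le_rfl) (Finset.measurable_sum _ fun n hn => ?_)
        exact hψ.comp (((hX n).mono (h₀ k) le_rfl).prodMk
          ((hU n).mono (hlt k n (Finset.mem_range.1 hn)) le_rfl))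
      have hF : Measurable fun p : (ENNReal × E) × B =>
          expNeg p.1.1 * expNeg (ψ (p.1.2, p.2)) := by
        refine Measurable.mul (measurable_expNeg.comp (measurable_fst.comp measurable_fst))
          (measurable_expNeg.comp (hψ.comp ?_))
        exact (measurable_snd.comp measurable_fst).prodMk measurable_snd
      have h1 := lintegral_eq_lintegral_lintegral_of_indep (hmF k) (hmk k) (hind k) hZ (hU k) hF
      have h2 := ih (fun ω => W ω + f (X k ω)) (Measurable.add hW (hf.comp (hX k)))
      calc ∫⁻ ω, expNeg (W ω + ∑ n ∈ Finset.range (k + 1), ψ (X n ω, U n ω)) ∂P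
          = ∫⁻ ω, expNeg (W ω + ∑ n ∈ Finset.range k, ψ (X n ω, U n ω)) *
              expNeg (ψ (X k ω, U k ω)) ∂P := by
            simp_rw [Finset.sum_range_succ, ← add_assoc, expNeg_add]
        _ = ∫⁻ ω, expNeg (W ω + f (X k ω) + ∑ n ∈ Finset.range k, ψ (X n ω, U n ω)) ∂P := by
            rw [h1]
            refine lintegral_congr fun ω => ?_
            have hm : Measurable fun ω' => expNeg (ψ (X k ω, U k ω')) :=
              measurable_expNeg.comp (hψ.comp
                (measurable_const.prodMk ((hU k).mono (hmk k) le_rfl)))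
            dsimp only
            rw [lintegral_const_mul _ hm, hfψ, ← expNeg_add]
            congr 1; ring
        _ = ∫⁻ ω, expNeg (W ω + ∑ n ∈ Finset.range (k + 1), f (X n ω)) ∂P := by
            rw [h2]
            refine lintegral_congr fun ω => ?_
            rw [Finset.sum_range_succ]
            congr 1; ring
  have hX' : ∀ n, Measurable (X n) := fun n => (hX n).mono ((h₀ n).trans (hmF n)) le_rfl
  have hU' : ∀ n, Measurable (U n) := fun n => (hU n).mono (hmk n) le_rfl
  have t1 : Tendsto (fun k => ∫⁻ ω, expNeg (∑ n ∈ Finset.range k, ψ (X n ω, U n ω)) ∂P) atTop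
      (𝓝 (∫⁻ ω, expNeg (∑' n, ψ (X n ω, U n ω)) ∂P)) :=
    tendsto_lintegral_expNeg (fun k => Finset.measurable_sum _ fun n _ =>
      hψ.comp ((hX' n).prodMk (hU' n))) fun ω => ENNReal.tendsto_nat_tsum _
  have t2 : Tendsto (fun k => ∫⁻ ω, expNeg (∑ n ∈ Finset.range k, f (X n ω)) ∂P) atTop
      (𝓝 (∫⁻ ω, expNeg (∑' n, f (X n ω)) ∂P)) :=
    tendsto_lintegral_expNeg (fun k => Finset.measurable_sum _ fun n _ =>
      hf.comp (hX' n)) fun ω => ENNReal.tendsto_nat_tsum _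
  refine tendsto_nhds_unique t1 (t2.congr fun k => ?_)
  simpa using (key k 0 measurable_const).symm

end Independence

/-! ### The standard exponential law. -/

section Exponential

lemma expMeasure_eq_withDensity (r : ℝ) :
    expMeasure r = volume.withDensity (exponentialPDF r) := rfl

/-- Laplace transform of the standard exponential law. -/
lemma lintegral_expNeg_expMeasure {t : ℝ} (ht : 0 ≤ t) :
    ∫⁻ h, expNeg (ENNReal.ofReal (t * h)) ∂(expMeasure 1) = ENNReal.ofReal (1 / (1 + t)) := by
  have hpdf : ∀ r, Measurable (exponentialPDF r) := fun r =>
    (measurable_exponentialPDFReal r).ennreal_ofReal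
  have hm : Measurable fun h : ℝ => expNeg (ENNReal.ofReal (t * h)) :=
    measurable_expNeg.comp (by fun_prop)
  rw [expMeasure_eq_withDensity, lintegral_withDensity_eq_lintegral_mul _ (hpdf 1) hm]
  have : ∀ h : ℝ, (exponentialPDF 1 * fun h => expNeg (ENNReal.ofReal (t * h))) h
      = ENNReal.ofReal (1 / (1 + t)) * exponentialPDF (1 + t) h := by
    intro h
    rcases lt_or_ge h 0 with h0 | h0
    · simp [exponentialPDF_of_neg h0]
    · rw [Pi.mul_apply, exponentialPDF_of_nonneg h0, exponentialPDF_of_nonneg h0,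
        expNeg_ofReal (by positivity), ← ENNReal.ofReal_mul (by positivity),
        ← ENNReal.ofReal_mul (by positivity), one_mul, ← Real.exp_add]
      congr 1
      field_simp
      congr 1; ring
  simp_rw [this]
  rw [lintegral_const_mul _ (hpdf _), lintegral_exponentialPDF_eq_one (by linarith), mul_one]

lemma lintegral_one_sub_expNeg_expMeasure {t : ℝ} (ht : 0 ≤ t) :
    ∫⁻ h, (1 - expNeg (ENNReal.ofReal (t * h))) ∂(expMeasure 1) =
      ENNReal.ofReal (1 - 1 / (1 + t)) := by
  have := isProbabilityMeasure_expMeasure one_pos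
  have hm : Measurable fun h : ℝ => expNeg (ENNReal.ofReal (t * h)) :=
    measurable_expNeg.comp (by fun_prop)
  rw [lintegral_sub hm _ (ae_of_all _ fun h => expNeg_le_one _), lintegral_expNeg_expMeasure ht]
  · rw [lintegral_const, measure_univ, mul_one, ENNReal.ofReal_sub _ (by positivity),
      ENNReal.ofReal_one]
  · rw [lintegral_expNeg_expMeasure ht]; exact ENNReal.ofReal_ne_top

/-- Tail of the standard exponential law. -/
lemma expMeasure_lt_ofReal {ρ : ℝ} (hρ : 0 < ρ) (y : ENNReal) :
    expMeasure 1 {h | y < ENNReal.ofReal (ρ * h)} = expNeg (ENNReal.ofReal (1 / ρ) * y) := by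
  have := isProbabilityMeasure_expMeasure one_pos
  induction y with
  | top => simp [hρ]
  | coe s =>
    have hset : {h : ℝ | (s : ENNReal) < ENNReal.ofReal (ρ * h)} = (Iic (s / ρ))ᶜ := by
      ext h
      rw [mem_ofPred_eq, mem_compl_iff, mem_Iic, not_le, ← ENNReal.ofReal_coe_nnreal,
        ENNReal.ofReal_lt_ofReal_iff_of_nonneg s.coe_nonneg, div_lt_iff₀ hρ, mul_comm]
    rw [hset, prob_compl_eq_one_sub measurableSet_Iic, ← ofReal_cdf, cdf_expMeasure_eq one_pos,
      if_pos (by positivity), ← ENNReal.ofReal_coe_nnreal, ← ENNReal.ofReal_mul (by positivity),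
      expNeg_ofReal (by positivity), ← ENNReal.ofReal_one, ← ENNReal.ofReal_sub]
    · congr 1
      rw [sub_sub_cancel]; congr 1; ring
    · rw [sub_nonneg, Real.exp_le_one_iff]
      have : 0 ≤ (s : ℝ) / ρ := by positivity
      linarith

end Exponential

/-! ### Averaged Cauchy kernels and the continued hypergeometric function. -/

section Hypergeometric

variable {α : Type*} [MeasurableSpace α] {μ : Measure α} {w T : α → ℝ}

/-- An affine function of `t` on `[0, 1]` is at least the smaller of its endpoint values. This
bounds the Cauchy kernel uniformly in `T`, and the bound serves as the radius of expansion at `x`.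
-/
lemma min_one_le_one_sub_mul {x t : ℝ} (h0 : 0 ≤ t) (h1 : t ≤ 1) :
    min 1 (1 - x) ≤ 1 - x * t := by
  rcases le_total x 0 with hx | hx
  · exact (min_le_left _ _).trans (by nlinarith)
  · exact (min_le_right _ _).trans (by nlinarith)

lemma norm_cauchyKernel_coeff_le (hT : ∀ᵐ a ∂μ, 0 ≤ T a ∧ T a ≤ 1) {x : ℝ} (hx : x < 1) (k : ℕ) :
    ∀ᵐ a ∂μ, ‖w a * (T a ^ k / (1 - x * T a) ^ (k + 1))‖
      ≤ ‖w a‖ * (1 / min 1 (1 - x) ^ (k + 1)) := by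
  filter_upwards [hT] with a ⟨h0, h1⟩
  have hm : 0 < min 1 (1 - x) := lt_min one_pos (by linarith)
  have hle := min_one_le_one_sub_mul (x := x) h0 h1
  rw [norm_mul]
  refine mul_le_mul_of_nonneg_left ?_ (norm_nonneg _)
  rw [Real.norm_of_nonneg (by have := hm.trans_le hle; positivity)]
  gcongr
  exact pow_le_one₀ h0 h1

lemma integrable_cauchyKernel_coeff (hw : Integrable w μ) (hTm : Measurable T)
    (hT : ∀ᵐ a ∂μ, 0 ≤ T a ∧ T a ≤ 1) {x : ℝ} (hx : x < 1) (k : ℕ) :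
    Integrable (fun a => w a * (T a ^ k / (1 - x * T a) ^ (k + 1))) μ := by
  refine Integrable.mono' (hw.norm.mul_const (1 / min 1 (1 - x) ^ (k + 1))) ?_
    (norm_cauchyKernel_coeff_le hT hx k)
  exact hw.aestronglyMeasurable.mul (Measurable.aestronglyMeasurable (by fun_prop))

/-- Expansion of an averaged Cauchy kernel around a point of `(-∞, 1)`. -/
lemma hasSum_integral_cauchyKernel (hw : Integrable w μ) (hTm : Measurable T)
    (hT : ∀ᵐ a ∂μ, 0 ≤ T a ∧ T a ≤ 1) {x y : ℝ} (hx : x < 1) (hy : |y| < min 1 (1 - x)) :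
    HasSum (fun k : ℕ => (∫ a, w a * (T a ^ k / (1 - x * T a) ^ (k + 1)) ∂μ) * y ^ k)
      (∫ a, w a / (1 - (x + y) * T a) ∂μ) := by
  set m := min 1 (1 - x)
  have hm : 0 < m := lt_min one_pos (by linarith)
  have hint := integrable_cauchyKernel_coeff hw hTm hT hx
  have hnorm : ∀ k, ∫ a, ‖w a * (T a ^ k / (1 - x * T a) ^ (k + 1)) * y ^ k‖ ∂μ
      ≤ (∫ a, ‖w a‖ ∂μ) * (1 / m) * (|y| / m) ^ k := by
    intro k
    calc ∫ a, ‖w a * (T a ^ k / (1 - x * T a) ^ (k + 1)) * y ^ k‖ ∂μ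
        ≤ ∫ a, ‖w a‖ * (1 / m ^ (k + 1) * |y| ^ k) ∂μ := by
          refine integral_mono_ae ((hint k).mul_const _).norm (hw.norm.mul_const _) ?_
          filter_upwards [norm_cauchyKernel_coeff_le (w := w) hT hx k] with a ha
          rw [norm_mul, norm_pow, Real.norm_eq_abs y, ← mul_assoc]
          exact mul_le_mul_of_nonneg_right ha (by positivity)
      _ = (∫ a, ‖w a‖ ∂μ) * (1 / m) * (|y| / m) ^ k := by
          rw [integral_mul_const, div_pow]; field_simp; ring
  have hsummable : Summable fun k => ∫ a, ‖w a * (T a ^ k / (1 - x * T a) ^ (k + 1)) * y ^ k‖ ∂μ := by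
    refine Summable.of_nonneg_of_le (fun k => integral_nonneg fun a => norm_nonneg _) hnorm ?_
    exact (summable_geometric_of_lt_one (by positivity) ((div_lt_one hm).2 hy)).mul_left _
  have h := hasSum_integral_of_summable_integral_norm (fun k => (hint k).mul_const (y ^ k)) hsummable
  simp_rw [integral_mul_const] at h
  suffices h' : ∫ a, w a / (1 - (x + y) * T a) ∂μ =
      ∫ a, ∑' k : ℕ, w a * (T a ^ k / (1 - x * T a) ^ (k + 1)) * y ^ k ∂μ by rwa [h']
  refine integral_congr_ae ?_
  filter_upwards [hT] with a ⟨h0, h1⟩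
  have hle : m ≤ 1 - x * T a := min_one_le_one_sub_mul h0 h1
  have hpos : 0 < 1 - x * T a := hm.trans_le hle
  have hq : |y * T a / (1 - x * T a)| < 1 := by
    rw [abs_div, abs_of_pos hpos, div_lt_one hpos, abs_mul, abs_of_nonneg h0]
    nlinarith [abs_nonneg y]
  -- Factoring out `1 - x T` turns the kernel at `x + y` into a geometric series with ratio `y T /
  -- (1 - x T)`.
  have hg := (hasSum_geometric_of_abs_lt_one hq).mul_left (w a / (1 - x * T a))
  have hne : 1 - (x + y) * T a ≠ 0 := by
    have : |y * T a| < 1 - x * T a := by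
      rwa [abs_div, abs_of_pos hpos, div_lt_one hpos] at hq
    have := (abs_lt.1 this).2
    intro h; linarith
  have e1 : w a / (1 - x * T a) * (1 - y * T a / (1 - x * T a))⁻¹ = w a / (1 - (x + y) * T a) := by
    have : 1 - y * T a / (1 - x * T a) = (1 - (x + y) * T a) / (1 - x * T a) := by
      rw [eq_div_iff hpos.ne', sub_mul, div_mul_cancel₀ _ hpos.ne']; ring
    rw [this, inv_div, div_mul_div_cancel₀ hpos.ne']
  rw [e1] at hg
  rw [← hg.tsum_eq]
  refine tsum_congr fun k => ?_
  rw [div_pow, mul_pow]; field_simp; ring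

/-- An averaged Cauchy kernel is analytic on `(-∞, 1)`. -/
lemma analyticOnNhd_integral_cauchyKernel (hw : Integrable w μ) (hTm : Measurable T)
    (hT : ∀ᵐ a ∂μ, 0 ≤ T a ∧ T a ≤ 1) :
    AnalyticOnNhd ℝ (fun x => ∫ a, w a / (1 - x * T a) ∂μ) (Iio 1) := by
  intro x hx
  have hx : x < 1 := hx
  set m := min 1 (1 - x)
  have hm : 0 < m := lt_min one_pos (by linarith)
  set c : ℕ → ℝ := fun k => ∫ a, w a * (T a ^ k / (1 - x * T a) ^ (k + 1)) ∂μ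
  have hc : ∀ k, ‖c k‖ ≤ (∫ a, ‖w a‖ ∂μ) * (1 / m ^ (k + 1)) := fun k => by
    rw [← integral_mul_const]
    exact norm_integral_le_of_norm_le (hw.norm.mul_const _) (norm_cauchyKernel_coeff_le hT hx k)
  refine ⟨FormalMultilinearSeries.ofScalars ℝ c, ENNReal.ofReal m, ⟨?_, by simpa using hm, ?_⟩⟩
  · refine FormalMultilinearSeries.le_radius_of_bound _ ((∫ a, ‖w a‖ ∂μ) * (1 / m)) fun k => ?_
    rw [FormalMultilinearSeries.ofScalars_norm, Real.coe_toNNReal _ hm.le]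
    calc ‖c k‖ * m ^ k ≤ (∫ a, ‖w a‖ ∂μ) * (1 / m ^ (k + 1)) * m ^ k := by
          gcongr; exact hc k
      _ = (∫ a, ‖w a‖ ∂μ) * (1 / m) := by field_simp; ring
  · intro y hy
    have hy' : |y| < m := by
      simpa [Metric.eball_ofReal, Real.norm_eq_abs] using hy
    have := hasSum_integral_cauchyKernel hw hTm hT hx hy'
    simpa [FormalMultilinearSeries.ofScalars_apply_eq, c, mul_comm] using this

/-- Exhibiting one continuation `F` activates the specification of `Classical.epsilon`; the identity
theorem on the connected set `(-∞, 1)` then forces the chosen function to equal `F`. -/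
lemma gaussHypergeometric_eq_of_analytic {a b c : ℝ} {F : ℝ → ℝ}
    (hF : AnalyticOnNhd ℝ F (Iio 1))
    (h0 : ∀ᶠ z in 𝓝 (0 : ℝ), F z = ordinaryHypergeometric a b c z) {x : ℝ} (hx : x < 1) :
    gaussHypergeometric a b c x = F x := by
  have hspec := Classical.epsilon_spec (p := fun F : ℝ → ℝ => AnalyticOnNhd ℝ F (Iio 1) ∧
    ∀ᶠ z in 𝓝 (0 : ℝ), F z = ordinaryHypergeometric a b c z) ⟨F, hF, h0⟩
  refine hspec.1.eqOn_of_preconnected_of_eventuallyEq hF isPreconnected_Iio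
    (mem_Iio.2 one_pos) ?_ hx
  filter_upwards [hspec.2, h0] with z h1 h2
  rw [h1, h2]

/-- The Pochhammer symbol of `1` cancels the factorial, and the ratio of those of `b` and `b + 1`
telescopes to `b / (b + k)`. -/
lemma ordinaryHypergeometric_one_add_one {b z : ℝ} (hb : 0 < b) :
    ordinaryHypergeometric 1 b (b + 1) z = ∑' k : ℕ, b / (b + k) * z ^ k := by
  rw [ordinaryHypergeometric_eq_tsum]
  refine tsum_congr fun k => ?_
  have h1 : (ascPochhammer ℝ k).eval 1 = k.factorial := by
    simp
  have h2 : (ascPochhammer ℝ k).eval b * (b + k) = b * (ascPochhammer ℝ k).eval (b + 1) := by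
    have e1 := ascPochhammer_succ_eval k b
    rw [← e1, ascPochhammer_succ_left]
    simp
  have h3 : 0 < (ascPochhammer ℝ k).eval (b + 1) := ascPochhammer_pos k _ (by linarith)
  have h4 : (k.factorial : ℝ) ≠ 0 := by positivity
  have h5 : b + k ≠ 0 := by positivity
  rw [h1, smul_eq_mul, inv_mul_cancel₀ h4, one_mul]
  congr 1
  rw [← div_eq_mul_inv, div_eq_div_iff h3.ne' h5, h2]

/-- Integral representation of the hypergeometric function of the interference. -/
lemma gaussHypergeometric_eq_integral {η x : ℝ} (hη : 2 < η) (hx : x < 1) :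
    gaussHypergeometric 1 (1 - 2 / η) (2 - 2 / η) x =
      ∫ u in Ioi (1 : ℝ), (η - 2) * u ^ (1 - η) / (1 - x * u ^ (-η)) := by
  have hw : Integrable (fun u : ℝ => (η - 2) * u ^ (1 - η)) (volume.restrict (Ioi 1)) :=
    (integrableOn_Ioi_rpow_of_lt (by linarith) one_pos).const_mul _
  have hTm : Measurable fun u : ℝ => u ^ (-η) := by fun_prop
  have hT : ∀ᵐ u ∂(volume.restrict (Ioi (1 : ℝ))), 0 ≤ u ^ (-η) ∧ u ^ (-η) ≤ 1 := by
    filter_upwards [ae_restrict_mem measurableSet_Ioi] with u hu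
    have hu : 1 < u := hu
    exact ⟨by positivity, Real.rpow_le_one_of_one_le_of_nonpos hu.le (by linarith)⟩
  refine gaussHypergeometric_eq_of_analytic (analyticOnNhd_integral_cauchyKernel hw hTm hT) ?_ hx
  have hb : 0 < 1 - 2 / η := by
    rw [sub_pos, div_lt_one (by linarith)]; exact hη
  filter_upwards [Metric.ball_mem_nhds (0 : ℝ) one_pos] with z hz
  have hz : |z| < 1 := by simpa using hz
  -- Expanded at `0`, the coefficients are power integrals `(η - 2) / (η (k + 1) - 2)`, which equal
  -- `b / (b + k)` for `b = 1 - 2 / η`.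
  have hs := hasSum_integral_cauchyKernel hw hTm hT (x := 0) (y := z) one_pos (by simpa using hz)
  rw [show (2 : ℝ) - 2 / η = (1 - 2 / η) + 1 by ring, ordinaryHypergeometric_one_add_one hb]
  rw [zero_add] at hs
  rw [← hs.tsum_eq]
  refine tsum_congr fun k => ?_
  congr 1
  have : ∀ u ∈ Ioi (1 : ℝ), (η - 2) * u ^ (1 - η) * ((u ^ (-η)) ^ k / (1 - 0 * u ^ (-η)) ^ (k + 1))
      = (η - 2) * u ^ (1 - η * (k + 1)) := by
    intro u hu
    have hu : 0 < u := one_pos.trans hu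
    rw [← Real.rpow_mul_natCast hu.le, zero_mul, sub_zero, one_pow, div_one, mul_assoc,
      ← Real.rpow_add hu]
    congr 2; ring
  rw [setIntegral_congr_fun measurableSet_Ioi this, integral_const_mul,
    integral_Ioi_rpow_of_lt (by nlinarith [(k.cast_nonneg : (0 : ℝ) ≤ k)]) one_pos, Real.one_rpow]
  have h1 : η ≠ 0 := by linarith
  have h2 : 0 < η * (k + 1) - 2 := by nlinarith [(k.cast_nonneg : (0 : ℝ) ≤ k)]
  have h3 : 1 - η * (k + 1) + 1 ≠ 0 := by linarith
  have h4 : 1 - 2 / η + k ≠ 0 := by positivity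
  rw [mul_div_assoc', div_eq_div_iff h3 h4]
  field_simp
  ring

end Hypergeometric

/-! ### Distance to the nearest base station. -/

section NearestDistance

lemma pointCount_eq_zero_iff {Ω E : Type*} {X : ℕ → Ω → E} {B : Set E} {ω : Ω} :
    pointCount X B ω = 0 ↔ ∀ i, X i ω ∉ B := by
  simp [pointCount, ENNReal.tsum_eq_zero]

/-- The non-strict inequality matches emptiness of the open ball, so the tail of the distance is a
void probability. -/
lemma le_nearestDist_iff {Ω : Type*} {Y : ℕ → Ω → Plane} {x : Plane} {ω : Ω} {t : ℝ} :
    t ≤ nearestDist Y x ω ↔ pointCount Y (Metric.ball x t) ω = 0 := by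
  rw [nearestDist, Metric.le_infDist (range_nonempty _), pointCount_eq_zero_iff, forall_mem_range]
  simp [dist_comm]

variable {Ω Ω' : Type*} [MeasurableSpace Ω] [MeasurableSpace Ω']

/-- Law of the distance to the nearest point of a planar Poisson process. -/
lemma IsHomogeneousPPP.measure_le_nearestDist {Q : Measure Ω'} {Y : ℕ → Ω' → Plane} {d : ℝ}
    (hd : 0 < d) (h : IsHomogeneousPPP Y d Q) (x : Plane) {t : ℝ} (ht : 0 ≤ t) :
    Q {ω | t ≤ nearestDist Y x ω} = ENNReal.ofReal (Real.exp (-(d * Real.pi) * t ^ 2)) := by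
  have hvol : (ENNReal.ofReal d • (volume : Measure Plane)) (Metric.ball x t)
      = ENNReal.ofReal (d * Real.pi * t ^ 2) := by
    rw [Measure.smul_apply, EuclideanSpace.volume_ball_fin_two, smul_eq_mul,
      ← ENNReal.ofReal_pow ht,
      ← ENNReal.ofReal_mul (by positivity), ← ENNReal.ofReal_mul hd.le]
    congr 1; ring
  have := h.law_count (Metric.ball x t) measurableSet_ball (by rw [hvol]; exact ENNReal.ofReal_ne_top) 0
  rw [hvol, poissonMeasure_singleton] at this
  simp_rw [le_nearestDist_iff]
  rw [Nat.cast_zero] at this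
  rw [this]
  have hnn : 0 ≤ d * Real.pi * t ^ 2 := by positivity
  congr 1
  simp [← ENNReal.toReal.eq_1, ENNReal.toReal_ofReal hnn]

/-- Second moment of the distance to the nearest point of a planar Poisson process. -/
lemma IsHomogeneousPPP.lintegral_sq_nearestDist {P : Measure Ω} {Q : Measure Ω'}
    {Y : ℕ → Ω' → Plane} {d : ℝ} (hd : 0 < d) (h : IsHomogeneousPPP Y d Q) {R : Ω → ℝ}
    (x : Plane) (hR : IdentDistrib R (nearestDist Y x) P Q) :
    ∫⁻ ω, ENNReal.ofReal (R ω ^ 2) ∂P = ENNReal.ofReal (1 / (d * Real.pi)) := by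
  have hdp : 0 < d * Real.pi := by positivity
  have hRD : ∫⁻ ω, ENNReal.ofReal (R ω ^ 2) ∂P
      = ∫⁻ ω, ENNReal.ofReal (nearestDist Y x ω ^ (2 : ℝ)) ∂Q := by
    simp_rw [Real.rpow_two]
    exact (hR.comp (u := fun r => ENNReal.ofReal (r ^ 2)) (by fun_prop)).lintegral_eq
  -- Layer-cake formula: the second moment is `2 ∫ t Q(t ≤ dist) dt`, a Gaussian integral.
  rw [hRD, lintegral_rpow_eq_lintegral_meas_le_mul Q (f := nearestDist Y x)
    (ae_of_all _ fun ω => Metric.infDist_nonneg) hR.aemeasurable_snd two_pos]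
  have hint := integrable_rpow_mul_exp_neg_mul_sq hdp (s := 1) (by norm_num)
  have hval := integral_rpow_mul_exp_neg_mul_rpow (p := 2) (q := 1) (b := d * Real.pi) two_pos
    (by norm_num) hdp
  have e1 : ∫⁻ t in Ioi (0 : ℝ), Q {ω | t ≤ nearestDist Y x ω} * ENNReal.ofReal (t ^ ((2 : ℝ) - 1))
      = ∫⁻ t in Ioi (0 : ℝ), ENNReal.ofReal (t ^ (1 : ℝ) * Real.exp (-(d * Real.pi) * t ^ (2 : ℝ))) := by
    refine setLIntegral_congr_fun measurableSet_Ioi fun t ht => ?_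
    have ht : 0 < t := ht
    rw [h.measure_le_nearestDist hd x ht.le, ← ENNReal.ofReal_mul (by positivity), Real.rpow_two]
    congr 1
    rw [mul_comm]; norm_num
  rw [e1, ← ofReal_integral_eq_lintegral_ofReal, hval, ← ENNReal.ofReal_mul two_pos.le]
  · congr 1
    norm_num
    rw [Real.rpow_neg_one, mul_inv]
    ring
  · simpa [Real.rpow_two] using hint.restrict
  · filter_upwards [ae_restrict_mem measurableSet_Ioi] with t ht
    have ht : 0 < t := ht
    simp only [Pi.zero_apply]
    positivity

end NearestDistance

/-! ### Spatial integral of the interference loss. -/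

section Spatial

/-- Expected reduction of the Laplace transform caused by an interferer at distance `s` with
service distance `r`. -/
def interferenceLoss (θ η r s : ℝ) : ℝ :=
  if r ^ η * s ^ (-η) < 1 then 1 - 1 / (1 + θ * (r ^ η * s ^ (-η))) else 0

lemma measurable_interferenceLoss (θ η : ℝ) :
    Measurable fun p : ℝ × ℝ => interferenceLoss θ η p.1 p.2 := by
  unfold interferenceLoss
  refine Measurable.ite (measurableSet_lt (by fun_prop) (by fun_prop)) (by fun_prop) (by fun_prop)

lemma interferenceLoss_nonneg {θ η r s : ℝ} (hθ : 0 < θ) (hr : 0 ≤ r) (hs : 0 ≤ s) :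
    0 ≤ interferenceLoss θ η r s := by
  unfold interferenceLoss
  split_ifs
  · have : 0 ≤ θ * (r ^ η * s ^ (-η)) := by positivity
    rw [sub_nonneg, div_le_one (by linarith)]; linarith
  · exact le_rfl

lemma integrableOn_interference_kernel {θ η : ℝ} (hθ : 0 < θ) (hη : 2 < η) :
    IntegrableOn (fun u : ℝ => θ * u ^ (1 - η) / (1 + θ * u ^ (-η))) (Ioi 1) := by
  have hw : Integrable (fun u : ℝ => θ * u ^ (1 - η)) (volume.restrict (Ioi 1)) :=
    (integrableOn_Ioi_rpow_of_lt (by linarith) one_pos).const_mul _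
  refine Integrable.mono' hw (Measurable.aestronglyMeasurable (by fun_prop)) ?_
  filter_upwards [ae_restrict_mem measurableSet_Ioi] with u hu
  have hu : 0 < u := one_pos.trans hu
  rw [Real.norm_of_nonneg (by positivity)]
  refine div_le_self (by positivity) ?_
  have : 0 ≤ θ * u ^ (-η) := by positivity
  linarith

lemma integral_interference_kernel {θ η : ℝ} (hθ : 0 < θ) (hη : 2 < η) :
    ∫ u in Ioi (1 : ℝ), θ * u ^ (1 - η) / (1 + θ * u ^ (-η)) =
      θ / (η - 2) * gaussHypergeometric 1 (1 - 2 / η) (2 - 2 / η) (-θ) := by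
  rw [gaussHypergeometric_eq_integral hη (by linarith), ← integral_const_mul]
  refine integral_congr_ae (ae_of_all _ fun u => ?_)
  have : η - 2 ≠ 0 := by linarith
  simp only [neg_mul, sub_neg_eq_add]
  rw [← mul_div_assoc, ← mul_assoc, div_mul_cancel₀ _ this]

/-- The integrand has the primitive `-(√θ / 2) arctan (√θ / u²)`, which vanishes at infinity. -/
lemma integral_interference_kernel_four {θ : ℝ} (hθ : 0 < θ) :
    ∫ u in Ioi (1 : ℝ), θ * u ^ (1 - (4 : ℝ)) / (1 + θ * u ^ (-(4 : ℝ))) =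
      √θ / 2 * Real.arctan √θ := by
  have hs : 0 < √θ := Real.sqrt_pos.2 hθ
  have hsq : √θ ^ 2 = θ := Real.sq_sqrt hθ.le
  have hd : ∀ u ∈ Ici (1 : ℝ), HasDerivAt (fun u : ℝ => -(√θ / 2 * Real.arctan (√θ * (u ^ 2)⁻¹)))
      (θ * u ^ (1 - (4 : ℝ)) / (1 + θ * u ^ (-(4 : ℝ)))) u := by
    intro u hu
    have hu : 0 < u := one_pos.trans_le hu
    have h1 : HasDerivAt (fun u : ℝ => √θ * (u ^ 2)⁻¹) (√θ * (-(2 * u) / (u ^ 2) ^ 2)) u := by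
      have := ((hasDerivAt_pow 2 u).inv (by positivity)).const_mul √θ
      simpa using this
    have h2 := (h1.arctan.const_mul (√θ / 2)).neg
    refine h2.congr_deriv ?_
    have e1 : u ^ (1 - (4 : ℝ)) = (u ^ 3)⁻¹ := by
      rw [← Real.rpow_natCast, ← Real.rpow_neg hu.le]; norm_num
    have e2 : u ^ (-(4 : ℝ)) = (u ^ 4)⁻¹ := by
      rw [← Real.rpow_natCast, ← Real.rpow_neg hu.le]; norm_num
    rw [e1, e2]
    have h3 : (√θ * (u ^ 2)⁻¹) ^ 2 = θ * (u ^ 4)⁻¹ := by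
      rw [mul_pow, hsq]; field_simp
    rw [h3]
    have h4 : √θ / 2 * (1 / (1 + θ * (u ^ 4)⁻¹) * (√θ * (-(2 * u) / (u ^ 2) ^ 2)))
        = -(√θ ^ 2 * (u ^ 3)⁻¹ / (1 + θ * (u ^ 4)⁻¹)) := by
      field_simp
    rw [h4, hsq, neg_neg]
  have hlim : Tendsto (fun u : ℝ => -(√θ / 2 * Real.arctan (√θ * (u ^ 2)⁻¹))) atTop (𝓝 0) := by
    have h1 : Tendsto (fun u : ℝ => √θ * (u ^ 2)⁻¹) atTop (𝓝 (√θ * 0)) :=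
      (tendsto_inv_atTop_zero.comp (tendsto_pow_atTop two_ne_zero)).const_mul _
    have h2 := ((Real.continuous_arctan.tendsto _).comp h1).const_mul (√θ / 2) |>.neg
    simpa using h2
  have := integral_Ioi_of_hasDerivAt_of_tendsto'
    hd (integrableOn_interference_kernel hθ (by norm_num)) hlim
  rw [this]; simp

/-- The factor `s` is the polar Jacobian. The loss depends only on `s / r` and lives on `s > r`;
pulling out one `r` here and a second from the substitution `s = r u` gives the scaling by `r ^ 2`.
-/
lemma mul_interferenceLoss {θ η r s : ℝ} (hθ : 0 < θ) (hη : 2 < η) (hr : 0 < r) (hs : 0 < s) :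
    s * interferenceLoss θ η r s = (Ioi r).indicator
      (fun s => r * (θ * (r⁻¹ * s) ^ (1 - η) / (1 + θ * (r⁻¹ * s) ^ (-η)))) s := by
  have e1 : r ^ η * s ^ (-η) = (r⁻¹ * s) ^ (-η) := by
    rw [Real.mul_rpow (by positivity) hs.le, Real.inv_rpow hr.le, Real.rpow_neg hr.le, inv_inv]
  have hq : 0 < r⁻¹ * s := by positivity
  have hiff : (r⁻¹ * s) ^ (-η) < 1 ↔ r < s := by
    rw [Real.rpow_lt_one_iff_of_pos hq, inv_mul_eq_div, one_lt_div hr, div_lt_one hr]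
    constructor
    · rintro (⟨h, -⟩ | ⟨-, h⟩)
      · exact h
      · linarith
    · exact fun h => Or.inl ⟨h, by linarith⟩
  rw [interferenceLoss, e1]
  by_cases h : r < s
  · rw [if_pos (hiff.2 h), indicator_of_mem (mem_Ioi.2 h), sub_eq_add_neg 1 η, Real.rpow_add hq,
      Real.rpow_one]
    have := Real.rpow_pos_of_pos hq (-η)
    generalize (r⁻¹ * s) ^ (-η) = v at *
    field_simp
    ring
  · rw [if_neg (fun h' => h (hiff.1 h')), indicator_of_notMem (fun h' => h (mem_Ioi.1 h')), mul_zero]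

/-- Spatial average of the interference loss. -/
lemma lintegral_interferenceLoss {θ η r : ℝ} (hθ : 0 < θ) (hη : 2 < η) (hr : 0 ≤ r) :
    ∫⁻ x : Plane, ENNReal.ofReal (interferenceLoss θ η r ‖x‖) =
      ENNReal.ofReal (2 * Real.pi * ∫ u in Ioi (1 : ℝ), θ * u ^ (1 - η) / (1 + θ * u ^ (-η))) *
        ENNReal.ofReal (r ^ 2) := by
  rcases hr.eq_or_lt with rfl | hr
  · simp [interferenceLoss, Real.zero_rpow (show η ≠ 0 by linarith)]
  set g : ℝ → ℝ := fun u => θ * u ^ (1 - η) / (1 + θ * u ^ (-η))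
  have hdim : Module.finrank ℝ Plane = 2 := by simp
  have hcongr : ∀ s ∈ Ioi (0 : ℝ), s ^ (Module.finrank ℝ Plane - 1) • interferenceLoss θ η r s
      = (Ioi r).indicator (fun s => r * g (r⁻¹ * s)) s := by
    intro s hs
    rw [hdim, smul_eq_mul, pow_one]
    exact mul_interferenceLoss hθ hη hr hs
  have hg : IntegrableOn (fun s => r * g (r⁻¹ * s)) (Ioi r) := by
    refine Integrable.const_mul ?_ r
    rw [← IntegrableOn, integrableOn_Ioi_comp_mul_left_iff g r (inv_pos.2 hr), inv_mul_cancel₀ hr.ne']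
    exact integrableOn_interference_kernel hθ hη
  have hint : Integrable (fun x : Plane => interferenceLoss θ η r ‖x‖) := by
    rw [integrable_fun_norm_addHaar volume, integrableOn_congr_fun hcongr measurableSet_Ioi]
    exact (hg.integrable_indicator measurableSet_Ioi).integrableOn
  rw [← ofReal_integral_eq_lintegral_ofReal hint
    (ae_of_all _ fun x => interferenceLoss_nonneg hθ hr.le (norm_nonneg _)),
    integral_fun_norm_addHaar volume, setIntegral_congr_fun measurableSet_Ioi hcongr,
    setIntegral_indicator measurableSet_Ioi, Ioi_inter_Ioi, max_eq_right hr.le,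
    integral_const_mul, integral_comp_mul_left_Ioi g r (inv_pos.2 hr), inv_mul_cancel₀ hr.ne',
    ← ENNReal.ofReal_mul' (by positivity)]
  congr 1
  have hball : (volume : Measure Plane).real (Metric.ball 0 1) = Real.pi := by
    simp [Measure.real, EuclideanSpace.volume_ball_fin_two, Real.pi_nonneg]
  rw [hdim, hball]
  simp only [smul_eq_mul, nsmul_eq_mul, inv_inv]
  push_cast
  ring

end Spatial

/-! ### Generating function of the cell count. -/

section NegativeBinomial

lemma gamma_natCast_add {c : ℝ} (hc : 0 < c) (n : ℕ) :
    Real.Gamma (n + c) = (ascPochhammer ℝ n).eval c * Real.Gamma c := by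
  induction n with
  | zero => simp
  | succ n ih =>
    have : (n : ℝ) + c ≠ 0 := by positivity
    rw [Nat.cast_succ, show (n : ℝ) + 1 + c = (n + c) + 1 by ring, Real.Gamma_add_one this, ih,
      ascPochhammer_succ_eval]
    ring

/-- Both sides are the rising factorial of `c` over `n!`. This identifies the Gamma weights with the
coefficients of the binomial series of `(1 - x) ^ (-c)`. -/
lemma choose_eq_gamma_div {c : ℝ} (hc : 0 < c) (n : ℕ) :
    Ring.choose (c + n - 1) n =
      Real.Gamma (n + c) / (Real.Gamma (n + 1) * Real.Gamma c) := by
  have h := Ring.factorial_nsmul_multichoose_eq_ascPochhammer c n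
  rw [Polynomial.ascPochhammer_smeval_cast, Polynomial.ascPochhammer_smeval_eq_eval, nsmul_eq_mul] at h
  have hn : (n.factorial : ℝ) ≠ 0 := by positivity
  have hG := (Real.Gamma_pos_of_pos hc).ne'
  rw [Ring.choose, show c + n - 1 - n + 1 = c by ring, gamma_natCast_add hc,
    Real.Gamma_nat_eq_factorial, ← h]
  field_simp

lemma hasSum_gamma_div_mul_pow {c x : ℝ} (hc : 0 < c) (hx : |x| < 1) :
    HasSum (fun n : ℕ => Real.Gamma (n + c) / (Real.Gamma (n + 1) * Real.Gamma c) * x ^ n)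
      (1 / (1 - x) ^ c) := by
  have hmem : x ∈ Metric.eball (0 : ℝ) 1 := by
    rw [← ENNReal.ofReal_one, Metric.eball_ofReal]; simpa using hx
  have := (Real.one_div_one_sub_rpow_hasFPowerSeriesOnBall_zero c).hasSum hmem
  simpa [FormalMultilinearSeries.ofScalars_apply_eq, choose_eq_gamma_div hc, mul_comm] using this

/-- Probability generating function of the number of points in a Voronoi cell. -/
lemma hasSum_voronoiCountPMF_mul_pow {κ lam s : ℝ} (hκ : 0 < κ) (hlam : 0 < lam) (hs : 0 ≤ s)
    (hs1 : s ≤ 1) :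
    HasSum (fun n => voronoiCountPMF κ lam n * s ^ n)
      (1 / (1 + κ * (1 - s) / (lam * voronoiConst)) ^ voronoiConst) := by
  have hc : 0 < voronoiConst := by unfold voronoiConst; norm_num
  set c := voronoiConst
  have hlc : 0 < lam * c := by positivity
  -- Collecting the `n`-th powers in the mass function and in `s ^ n` gives this argument for the
  -- binomial series.
  have hx : |κ * s / (κ + lam * c)| < 1 := by
    rw [abs_of_nonneg (by positivity), div_lt_one (by positivity)]
    nlinarith
  have h := (hasSum_gamma_div_mul_pow hc hx).mul_right ((lam * c) ^ c / (κ + lam * c) ^ c)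
  have hd : 0 < κ * (1 - s) + lam * c := by nlinarith
  have hval : 1 / (1 - κ * s / (κ + lam * c)) ^ c * ((lam * c) ^ c / (κ + lam * c) ^ c)
      = 1 / (1 + κ * (1 - s) / (lam * c)) ^ c := by
    rw [show 1 - κ * s / (κ + lam * c) = (κ * (1 - s) + lam * c) / (κ + lam * c) by
        field_simp; ring,
      show 1 + κ * (1 - s) / (lam * c) = (κ * (1 - s) + lam * c) / (lam * c) by
        field_simp; ring,
      Real.div_rpow hd.le (by positivity), Real.div_rpow hd.le hlc.le]
    have := Real.rpow_pos_of_pos hd c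
    have := Real.rpow_pos_of_pos hlc c
    have : 0 < (κ + lam * c) ^ c := by positivity
    field_simp
  rw [hval] at h
  refine h.congr_fun ?_
  intro n
  have h1 : (κ + lam * c) ^ ((n : ℝ) + c) = (κ + lam * c) ^ n * (κ + lam * c) ^ c := by
    rw [Real.rpow_add (by positivity), Real.rpow_natCast]
  have : 0 < (κ + lam * c) ^ c := by positivity
  have hG := Real.Gamma_pos_of_pos hc
  rw [voronoiCountPMF]
  change Real.Gamma (n + c) / (Real.Gamma (n + 1) * Real.Gamma c) *
    (κ ^ n * (lam * c) ^ c / (κ + lam * c) ^ ((n : ℝ) + c)) * s ^ n = _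
  rw [h1, div_pow, mul_pow]
  ring

lemma voronoiCountPMF_nonneg {κ lam : ℝ} (hκ : 0 < κ) (hlam : 0 < lam) (n : ℕ) :
    0 ≤ voronoiCountPMF κ lam n := by
  have hc : 0 < voronoiConst := by unfold voronoiConst; norm_num
  have h1 := Real.Gamma_pos_of_pos hc
  have h2 : 0 < Real.Gamma (n + voronoiConst) := Real.Gamma_pos_of_pos (by positivity)
  have h3 : 0 < Real.Gamma (n + 1) := Real.Gamma_pos_of_pos (by positivity)
  unfold voronoiCountPMF
  positivity

end NegativeBinomial

/-! ### Measurability with respect to the sources of randomness. -/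

namespace RandomAccess

section Measurability

variable {Ω : Type*} {nZ : ℕ} {S : RandomAccess Ω nZ}

/-- The sigma-algebra generated by a set of sources of randomness. -/
@[reducible] def sigmaOf (S : RandomAccess Ω nZ) (s : Set RandomSource) : MeasurableSpace Ω :=
  ⨆ i ∈ s, S.sigma i

lemma sigma_le_sigmaOf {s : Set RandomSource} {i : RandomSource} (hi : i ∈ s) :
    S.sigma i ≤ S.sigmaOf s := le_iSup₂ (f := fun i (_ : i ∈ s) => S.sigma i) i hi

lemma sigmaOf_mono {s t : Set RandomSource} (h : s ⊆ t) : S.sigmaOf s ≤ S.sigmaOf t :=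
  iSup₂_le fun _ hi => sigma_le_sigmaOf (h hi)

variable {s : Set RandomSource}

lemma measurable_pos_sigmaOf (h : .pos ∈ s) (m : ℕ) : Measurable[S.sigmaOf s] (S.pos m) :=
  (Measurable.of_comap_le (le_iSup (fun m => MeasurableSpace.comap (S.pos m) inferInstance) m)).mono
    (sigma_le_sigmaOf h) le_rfl

lemma measurable_isCH_sigmaOf {m : ℕ} (h : .isCH m ∈ s) : Measurable[S.sigmaOf s] (S.isCH m) :=
  (comap_measurable _).mono (sigma_le_sigmaOf h) le_rfl

lemma measurable_code_sigmaOf {m : ℕ} (h : .code m ∈ s) : Measurable[S.sigmaOf s] (S.code m) :=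
  (comap_measurable _).mono (sigma_le_sigmaOf h) le_rfl

lemma measurable_servDist_sigmaOf {m : ℕ} (h : .servDist m ∈ s) :
    Measurable[S.sigmaOf s] (S.servDist m) :=
  (comap_measurable _).mono (sigma_le_sigmaOf h) le_rfl

lemma measurable_gain_sigmaOf {m : ℕ} (h : .gain m ∈ s) : Measurable[S.sigmaOf s] (S.gain m) :=
  (comap_measurable _).mono (sigma_le_sigmaOf h) le_rfl

lemma measurable_testGain_sigmaOf (h : .testGain ∈ s) : Measurable[S.sigmaOf s] S.testGain :=
  (comap_measurable _).mono (sigma_le_sigmaOf h) le_rfl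

lemma measurable_neighbours_sigmaOf (h : .neighbours ∈ s) :
    Measurable[S.sigmaOf s] S.neighbours :=
  (comap_measurable _).mono (sigma_le_sigmaOf h) le_rfl

lemma measurable_intraGain_sigmaOf {i : ℕ} (h : .intraGain i ∈ s) :
    Measurable[S.sigmaOf s] (S.intraGain i) :=
  (comap_measurable _).mono (sigma_le_sigmaOf h) le_rfl

/-- Marks of device `m`: CH indicator, code, service distance and channel gain. -/
def mark (S : RandomAccess Ω nZ) (m : ℕ) (ω : Ω) : Bool × Fin nZ × ℝ × ℝ :=
  (S.isCH m ω, S.code m ω, S.servDist m ω, S.gain m ω)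

/-- Sources of the marks of device `m`. -/
def markSource (m : ℕ) : Set RandomSource := {.isCH m, .code m, .servDist m, .gain m}

/-- Sources of the inter-cell interference. -/
def interSource : Set RandomSource := {.pos} ∪ ⋃ m, markSource m

/-- Sources of the intra-cell interference. -/
def intraSource : Set RandomSource := {.neighbours} ∪ range .intraGain

lemma measurable_mark_sigmaOf {m : ℕ} (h : markSource m ⊆ s) :
    Measurable[S.sigmaOf s] (S.mark m) :=
  (measurable_isCH_sigmaOf (h (by simp [markSource]))).prodMk
    ((measurable_code_sigmaOf (h (by simp [markSource]))).prodMk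
      ((measurable_servDist_sigmaOf (h (by simp [markSource]))).prodMk
        (measurable_gain_sigmaOf (h (by simp [markSource])))))

/-- Interference received from a device at location `x` with marks `u`. -/
def deviceInterference (z : Fin nZ) (ρ η : ℝ) (p : Plane × Bool × Fin nZ × ℝ × ℝ) : ENNReal :=
  if p.2.1 = true ∧ p.2.2.1 = z ∧ ρ * p.2.2.2.1 ^ η * ‖p.1‖ ^ (-η) < ρ then
    ENNReal.ofReal (ρ * p.2.2.2.1 ^ η * p.2.2.2.2 * ‖p.1‖ ^ (-η)) else 0

lemma measurable_deviceInterference (z : Fin nZ) (ρ η : ℝ) :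
    Measurable (deviceInterference z ρ η) := by
  unfold deviceInterference
  refine Measurable.ite ?_ (by fun_prop) measurable_const
  refine MeasurableSet.inter ?_ (MeasurableSet.inter ?_ ?_)
  · exact (measurable_fst.comp measurable_snd) (measurableSet_singleton true)
  · exact (measurable_fst.comp (measurable_snd.comp measurable_snd)) (measurableSet_singleton z)
  · have : MeasurableSet {p : Plane × Bool × Fin nZ × ℝ × ℝ |
        ρ * p.2.2.2.1 ^ η * ‖p.1‖ ^ (-η) < ρ} := measurableSet_lt (by fun_prop) measurable_const
    exact this

lemma interInterference_eq_tsum (z : Fin nZ) (ρ η : ℝ) (ω : Ω) :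
    S.interInterference z ρ η ω =
      ∑' m, deviceInterference z ρ η (S.pos m ω, S.mark m ω) := by
  unfold interInterference
  refine tsum_congr fun m => ?_
  by_cases h : m ∈ S.interCell z ρ η ω
  · rw [indicator_of_mem h, deviceInterference]
    exact (if_pos h).symm
  · rw [indicator_of_notMem h, deviceInterference]
    exact (if_neg h).symm

lemma measurable_interInterference_sigmaOf (h : interSource ⊆ s) (z : Fin nZ) (ρ η : ℝ) :
    Measurable[S.sigmaOf s] (S.interInterference z ρ η) := by
  let _ : MeasurableSpace Ω := S.sigmaOf s
  rw [funext (interInterference_eq_tsum z ρ η)]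
  refine Measurable.tsum fun m => (measurable_deviceInterference z ρ η).comp ?_
  exact (measurable_pos_sigmaOf (h (by simp [interSource])) m).prodMk
    (measurable_mark_sigmaOf ((subset_iUnion _ m).trans (subset_union_right.trans h)))

/-- Intra-cell interference as a function of the number of interferers and their gains. -/
def gainSum (ρ : ℝ) (p : ℕ × (ℕ → ℝ)) : ENNReal :=
  ∑ i ∈ Finset.range p.1, ENNReal.ofReal (ρ * p.2 i)

lemma measurable_gainSum (ρ : ℝ) : Measurable (gainSum ρ) := by
  refine measurable_from_prod_countable_right fun n => ?_
  have : Measurable fun y : ℕ → ℝ => ∑ i ∈ Finset.range n, ENNReal.ofReal (ρ * y i) :=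
    Finset.measurable_sum _ fun i _ => by fun_prop
  exact this

lemma measurable_intraGains_sigmaOf (h : range RandomSource.intraGain ⊆ s) :
    Measurable[S.sigmaOf s] (fun ω i => S.intraGain i ω) :=
  @measurable_pi_lambda _ _ _ (S.sigmaOf s) _ _
    fun i => measurable_intraGain_sigmaOf (h (mem_range_self i))

lemma measurable_intraInterference_sigmaOf (h : intraSource ⊆ s) (ρ : ℝ) :
    Measurable[S.sigmaOf s] (S.intraInterference ρ) :=
  (measurable_gainSum ρ).comp ((measurable_neighbours_sigmaOf (h (by simp [intraSource]))).prodMk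
    (measurable_intraGains_sigmaOf (subset_union_right.trans h)))

end Measurability

/-! ### Laplace transforms of the interference and the success probability. -/

namespace IsRBC

variable {Ω Ω' : Type*} [mΩ : MeasurableSpace Ω] [MeasurableSpace Ω'] {P : Measure Ω}
  {Q : Measure Ω'} {lam mu δ : ℝ} {nZ : ℕ} {bs : ℕ → Ω' → Plane} {S : RandomAccess Ω nZ}

lemma sigma_le (hS : S.IsRBC P bs Q lam mu δ) : ∀ i, S.sigma i ≤ mΩ
  | .pos => iSup_le fun m => (hS.pos_ppp.measurable m).comap_le
  | .isCH m => (hS.measurable_isCH m).comap_le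
  | .code m => (hS.measurable_code m).comap_le
  | .servDist m => (hS.measurable_servDist m).comap_le
  | .gain m => (hS.measurable_gain m).comap_le
  | .testGain => hS.measurable_testGain.comap_le
  | .neighbours => hS.measurable_neighbours.comap_le
  | .intraGain i => (hS.measurable_intraGain i).comap_le

lemma sigmaOf_le (hS : S.IsRBC P bs Q lam mu δ) (s : Set RandomSource) : S.sigmaOf s ≤ mΩ :=
  iSup₂_le fun i _ => hS.sigma_le i

/-- Joint independence of the sources passes to disjoint blocks; the factorisations below mostly
reduce to comparing sets of labels. -/
lemma indep_sigmaOf (hS : S.IsRBC P bs Q lam mu δ) {s t : Set RandomSource} (h : Disjoint s t) :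
    Indep (S.sigmaOf s) (S.sigmaOf t) P :=
  indep_iSup_of_disjoint hS.sigma_le hS.indep h

/-- Laplace transform of the intra-cell interference. -/
lemma lintegral_expNeg_intraInterference [IsProbabilityMeasure P]
    (hS : S.IsRBC P bs Q lam mu δ) {ρ θ : ℝ} (hρ : 0 < ρ) (hθ : 0 < θ) (hlam : 0 < lam)
    (hκ : 0 < δ * mu / nZ) :
    ∫⁻ ω, expNeg (ENNReal.ofReal (θ / ρ) * S.intraInterference ρ ω) ∂P =
      ENNReal.ofReal (1 / (1 + δ * mu / nZ * (1 - 1 / (1 + θ)) / (lam * voronoiConst))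
        ^ voronoiConst) := by
  have hs0 : 0 ≤ 1 / (1 + θ) := by positivity
  have hs1 : 1 / (1 + θ) ≤ 1 := by rw [div_le_one (by linarith)]; linarith
  -- One interferer has received power `ρ h`; at `θ / ρ` its transform is that of `h` at `θ`, namely
  -- `1 / (1 + θ)`, the point at which the generating function is taken.
  have hsum := hasSum_voronoiCountPMF_mul_pow hκ hlam hs0 hs1
  have hdisj : Disjoint {RandomSource.neighbours} (range RandomSource.intraGain) := by simp
  have h1 := lintegral_eq_lintegral_lintegral_of_indep (hS.sigmaOf_le _) (hS.sigmaOf_le _)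
    (hS.indep_sigmaOf hdisj) (measurable_neighbours_sigmaOf (mem_singleton _))
    (measurable_intraGains_sigmaOf Subset.rfl)
    (measurable_expNeg.comp ((measurable_gainSum ρ).const_mul (ENNReal.ofReal (θ / ρ))))
  have hind : iIndepFun S.intraGain P :=
    hS.indep.precomp (g := RandomSource.intraGain) fun i j h => by simpa using h
  have hinner : ∀ n : ℕ, ∫⁻ ω, expNeg (ENNReal.ofReal (θ / ρ) *
      gainSum ρ (n, fun i => S.intraGain i ω)) ∂P = ENNReal.ofReal (1 / (1 + θ)) ^ n := by
    intro n
    have hm : Measurable fun h : ℝ => expNeg (ENNReal.ofReal (θ * h)) :=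
      measurable_expNeg.comp (by fun_prop)
    calc ∫⁻ ω, expNeg (ENNReal.ofReal (θ / ρ) * gainSum ρ (n, fun i => S.intraGain i ω)) ∂P
        = ∫⁻ ω, ∏ i ∈ Finset.range n, expNeg (ENNReal.ofReal (θ * S.intraGain i ω)) ∂P := by
          refine lintegral_congr fun ω => ?_
          rw [gainSum, Finset.mul_sum, expNeg_sum]
          refine Finset.prod_congr rfl fun i _ => ?_
          rw [← ENNReal.ofReal_mul (by positivity)]
          congr 2; field_simp
      _ = ∏ i ∈ Finset.range n, ∫⁻ ω, expNeg (ENNReal.ofReal (θ * S.intraGain i ω)) ∂P :=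
          lintegral_prod_eq_prod_lintegral_of_indepFun _
            (fun i ω => expNeg (ENNReal.ofReal (θ * S.intraGain i ω)))
            (hind.comp (fun _ h => expNeg (ENNReal.ofReal (θ * h))) fun _ => hm)
            (fun i => hm.comp (hS.measurable_intraGain i))
      _ = ENNReal.ofReal (1 / (1 + θ)) ^ n := by
          have : ∀ i, ∫⁻ ω, expNeg (ENNReal.ofReal (θ * S.intraGain i ω)) ∂P
              = ENNReal.ofReal (1 / (1 + θ)) := fun i => by
            rw [← lintegral_expNeg_expMeasure hθ.le, ← hS.law_intraGain i,
              lintegral_map hm (hS.measurable_intraGain i)]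
          simp [this]
  simp only [Function.comp_apply, hinner] at h1
  refine h1.trans ?_
  rw [← lintegral_map (f := fun n => ENNReal.ofReal (1 / (1 + θ)) ^ n) (measurable_of_countable _)
    hS.measurable_neighbours, lintegral_countable']
  have hP : ∀ n, P.map S.neighbours {n} = ENNReal.ofReal (voronoiCountPMF (δ * mu / nZ) lam n) := by
    intro n
    rw [Measure.map_apply hS.measurable_neighbours (measurableSet_singleton n)]
    exact hS.prob_neighbours n
  have hnn := voronoiCountPMF_nonneg hκ hlam
  rw [← hsum.tsum_eq, ENNReal.ofReal_tsum_of_nonneg (fun n => mul_nonneg (hnn n) (by positivity))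
    hsum.summable]
  refine tsum_congr fun n => ?_
  rw [hP, ENNReal.ofReal_mul (hnn n), ENNReal.ofReal_pow hs0, mul_comm]

/-- Service distances are arbitrary real variables in the model; their sign comes only from the
common law with a distance. -/
lemma ae_servDist_nonneg (hS : S.IsRBC P bs Q lam mu δ) (m : ℕ) : ∀ᵐ ω ∂P, 0 ≤ S.servDist m ω :=
  (hS.law_servDist m).symm.ae_snd (p := fun r => 0 ≤ r) measurableSet_Ici
    (ae_of_all _ fun _ => Metric.infDist_nonneg)

/-- Mean loss of Laplace transform caused by a device at a given location. -/
lemma lintegral_one_sub_expNeg_deviceInterference [IsProbabilityMeasure P]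
    (hS : S.IsRBC P bs Q lam mu δ) {ρ θ η : ℝ} (hρ : 0 < ρ) (hθ : 0 < θ) (z : Fin nZ) (m : ℕ)
    (x : Plane) :
    ∫⁻ ω, (1 - expNeg (ENNReal.ofReal (θ / ρ) * deviceInterference z ρ η (x, S.mark m ω))) ∂P =
      ENNReal.ofReal δ * ((nZ : ENNReal)⁻¹ *
        ∫⁻ ω, ENNReal.ofReal (interferenceLoss θ η (S.servDist m ω) ‖x‖) ∂P) := by
  set F : ℝ × ℝ → ENNReal := fun p => if p.1 ^ η * ‖x‖ ^ (-η) < 1 then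
    1 - expNeg (ENNReal.ofReal (θ * (p.1 ^ η * ‖x‖ ^ (-η)) * p.2)) else 0
  have hF : Measurable F := by
    refine Measurable.ite (measurableSet_lt (by fun_prop) measurable_const) ?_ measurable_const
    exact measurable_const.sub (measurable_expNeg.comp (by fun_prop))
  set B : Bool → ENNReal := fun b => if b = true then 1 else 0
  set C : Fin nZ → ENNReal := fun c => if c = z then 1 else 0
  have hB : Measurable B := measurable_of_countable _
  have hC : Measurable C := measurable_of_countable _
  -- Unlike `expNeg` itself, the loss `1 - expNeg` vanishes when the device is silent, so the CH and
  -- code conditions enter as multiplicative indicators and can be averaged separately.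
  have hprod : ∀ ω, 1 - expNeg (ENNReal.ofReal (θ / ρ) * deviceInterference z ρ η (x, S.mark m ω))
      = B (S.isCH m ω) * (C (S.code m ω) * F (S.servDist m ω, S.gain m ω)) := by
    intro ω
    have hcond : ρ * S.servDist m ω ^ η * ‖x‖ ^ (-η) < ρ ↔ S.servDist m ω ^ η * ‖x‖ ^ (-η) < 1 := by
      rw [mul_assoc, mul_lt_iff_lt_one_right hρ]
    have hval : ENNReal.ofReal (θ / ρ) *
        ENNReal.ofReal (ρ * S.servDist m ω ^ η * S.gain m ω * ‖x‖ ^ (-η)) =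
        ENNReal.ofReal (θ * (S.servDist m ω ^ η * ‖x‖ ^ (-η)) * S.gain m ω) := by
      rw [← ENNReal.ofReal_mul (by positivity)]
      congr 1; field_simp
    simp only [deviceInterference, mark, hcond, B, C, F]
    by_cases h1 : S.isCH m ω = true <;> by_cases h2 : S.code m ω = z <;>
      by_cases h3 : S.servDist m ω ^ η * ‖x‖ ^ (-η) < 1 <;> simp [h1, h2, h3, hval]
  simp_rw [hprod]
  have hRh : Measurable[S.sigmaOf {.servDist m, .gain m}]
      fun ω => F (S.servDist m ω, S.gain m ω) :=
    hF.comp ((measurable_servDist_sigmaOf (by simp)).prodMk (measurable_gain_sigmaOf (by simp)))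
  have hCF : Measurable[S.sigmaOf {.code m, .servDist m, .gain m}]
      fun ω => C (S.code m ω) * F (S.servDist m ω, S.gain m ω) :=
    Measurable.mul (hC.comp (measurable_code_sigmaOf (by simp)))
      (hRh.mono (sigmaOf_mono (by simp)) le_rfl)
  have hBm : Measurable[S.sigmaOf {.isCH m}] fun ω => B (S.isCH m ω) :=
    hB.comp (measurable_isCH_sigmaOf (mem_singleton _))
  have hCm : Measurable[S.sigmaOf {.code m}] fun ω => C (S.code m ω) :=
    hC.comp (measurable_code_sigmaOf (mem_singleton _))
  rw [lintegral_mul_eq_lintegral_mul_lintegral_of_independent_measurableSpace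
      (hS.sigmaOf_le _) (hS.sigmaOf_le _) (hS.indep_sigmaOf (by simp)) hBm hCF,
    lintegral_mul_eq_lintegral_mul_lintegral_of_independent_measurableSpace
      (hS.sigmaOf_le _) (hS.sigmaOf_le _) (hS.indep_sigmaOf (by simp)) hCm hRh,
    lintegral_eq_lintegral_lintegral_of_indep
      (hS.sigmaOf_le {.servDist m}) (hS.sigmaOf_le {.gain m})
      (hS.indep_sigmaOf (by simp)) (measurable_servDist_sigmaOf (mem_singleton _))
      (measurable_gain_sigmaOf (mem_singleton _)) hF]
  congr 1
  · have : ∀ ω, B (S.isCH m ω) = {ω | S.isCH m ω = true}.indicator (fun _ => 1) ω := fun ω => by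
      simp [B, Set.indicator_apply]
    simp_rw [this]
    have hm : MeasurableSet {ω | S.isCH m ω = true} :=
      hS.measurable_isCH m (measurableSet_singleton true)
    rw [lintegral_indicator_const hm, one_mul, hS.prob_isCH]
  congr 1
  · have : ∀ ω, C (S.code m ω) = {ω | S.code m ω = z}.indicator (fun _ => 1) ω := fun ω => by
      simp [C, Set.indicator_apply]
    simp_rw [this]
    have hm : MeasurableSet {ω | S.code m ω = z} :=
      hS.measurable_code m (measurableSet_singleton z)
    rw [lintegral_indicator_const hm, one_mul, hS.prob_code]
  · refine lintegral_congr_ae ?_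
    filter_upwards [hS.ae_servDist_nonneg m] with ω hω
    simp only [F, interferenceLoss]
    split_ifs
    · have ht : 0 ≤ θ * (S.servDist m ω ^ η * ‖x‖ ^ (-η)) := by positivity
      have hm : Measurable fun h : ℝ =>
          1 - expNeg (ENNReal.ofReal (θ * (S.servDist m ω ^ η * ‖x‖ ^ (-η)) * h)) :=
        measurable_const.sub (measurable_expNeg.comp (by fun_prop))
      rw [← lintegral_one_sub_expNeg_expMeasure ht, ← hS.law_gain m,
        lintegral_map hm (hS.measurable_gain m)]
    · simp

/-- Laplace transform of the inter-cell interference. -/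
lemma lintegral_expNeg_interInterference [IsProbabilityMeasure P]
    (hS : S.IsRBC P bs Q lam mu δ) {ρ θ η : ℝ} (hρ : 0 < ρ) (hθ : 0 < θ) (hη : 2 < η)
    (hlam : 0 < lam) (hmu : 0 < mu) (hδ : 0 < δ) (z : Fin nZ) :
    ∫⁻ ω, expNeg (ENNReal.ofReal (θ / ρ) * S.interInterference z ρ η ω) ∂P =
      ENNReal.ofReal (Real.exp (-(2 * δ * (mu / lam) / nZ *
        ∫ u in Ioi (1 : ℝ), θ * u ^ (1 - η) / (1 + θ * u ^ (-η))))) := by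
  set K := ∫ u in Ioi (1 : ℝ), θ * u ^ (1 - η) / (1 + θ * u ^ (-η))
  have hK : 0 ≤ K := setIntegral_nonneg measurableSet_Ioi fun u hu => by
    have : 0 < u := one_pos.trans hu
    positivity
  have hn : (0 : ℝ) < nZ := by exact_mod_cast (Nat.zero_le _).trans_lt z.isLt
  set a := ENNReal.ofReal (θ / ρ)
  set ψ : Plane × Bool × Fin nZ × ℝ × ℝ → ENNReal := fun p => a * deviceInterference z ρ η p
  have hψ : Measurable ψ := (measurable_deviceInterference z ρ η).const_mul a
  -- Device `0` stands for all: service distances share one law, so the mean loss does not depend on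
  -- the index.
  set L : Plane → ENNReal := fun x => ENNReal.ofReal δ * ((nZ : ENNReal)⁻¹ *
    ∫⁻ ω, ENNReal.ofReal (interferenceLoss θ η (S.servDist 0 ω) ‖x‖) ∂P)
  have hloss : Measurable fun p : Plane × Ω =>
      ENNReal.ofReal (interferenceLoss θ η (S.servDist 0 p.2) ‖p.1‖) :=
    ((measurable_interferenceLoss θ η).comp
      (((hS.measurable_servDist 0).comp measurable_snd).prodMk
        (measurable_norm.comp measurable_fst))).ennreal_ofReal
  have hLm : Measurable L := (hloss.lintegral_prod_right'.const_mul _).const_mul _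
  have hmark : ∀ n, Measurable (S.mark n) := fun n =>
    (measurable_mark_sigmaOf Subset.rfl).mono (hS.sigmaOf_le (markSource n)) le_rfl
  have hψx : ∀ n x, Measurable fun ω => expNeg (ψ (x, S.mark n ω)) := fun n x =>
    measurable_expNeg.comp (hψ.comp (measurable_const.prodMk (hmark n)))
  have hL : ∀ n x, ∫⁻ ω, (1 - expNeg (ψ (x, S.mark n ω))) ∂P = L x := by
    intro n x
    rw [hS.lintegral_one_sub_expNeg_deviceInterference hρ hθ z n x]
    have hid : IdentDistrib (S.servDist n) (S.servDist 0) P P :=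
      (hS.law_servDist n).trans (hS.law_servDist 0).symm
    have := (hid.comp (u := fun r => ENNReal.ofReal (interferenceLoss θ η r ‖x‖))
      ((measurable_interferenceLoss θ η).comp
        (measurable_id.prodMk measurable_const)).ennreal_ofReal).lintegral_eq
    simp only [Function.comp_def] at this
    rw [this]
  have hL1 : ∀ x, L x ≤ 1 := fun x => by
    rw [← hL 0 x]
    calc ∫⁻ ω, (1 - expNeg (ψ (x, S.mark 0 ω))) ∂P ≤ ∫⁻ _, 1 ∂P :=
          lintegral_mono fun ω => tsub_le_self
      _ = 1 := by simp
  have hG : ∀ n x, ∫⁻ ω, expNeg (ψ (x, S.mark n ω)) ∂P = 1 - L x := by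
    intro n x
    have hadd : (∫⁻ ω, expNeg (ψ (x, S.mark n ω)) ∂P) + L x = 1 := by
      rw [← hL n x, ← lintegral_add_left (hψx n x)]
      simp [add_tsub_cancel_of_le (expNeg_le_one _)]
    exact ENNReal.eq_sub_of_add_eq ((hL1 x).trans_lt ENNReal.one_lt_top).ne hadd
  -- Chosen so that `expNeg (f x)` is the mark average `1 - L x`; hence the Poisson exponent `1 -
  -- expNeg (f x)` is `L x` again.
  set f : Plane → ENNReal := fun x => (-(ENNReal.log (1 - L x))).toENNReal
  have hf : Measurable f := ((ENNReal.measurable_log.comp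
    (measurable_const.sub hLm)).neg).ereal_toENNReal
  have hfL : ∀ x, expNeg (f x) = 1 - L x := fun x => exists_expNeg_eq tsub_le_self
  -- The complement of the marks of device `n` contains the positions and the marks of all other
  -- devices, which is what the one-at-a-time averaging conditions on.
  have hind : ∀ n, Indep (S.sigmaOf (markSource n)ᶜ) (S.sigmaOf (markSource n)) P :=
    fun n => hS.indep_sigmaOf disjoint_compl_left
  have h₀ : ∀ n, S.sigmaOf {.pos} ≤ S.sigmaOf (markSource n)ᶜ := fun n =>
    sigmaOf_mono (by simp [markSource])
  have hlt : ∀ n j, j < n → S.sigmaOf (markSource j) ≤ S.sigmaOf (markSource n)ᶜ := fun n j hj =>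
    sigmaOf_mono (by simp [markSource, Set.insert_subset_iff, hj.ne])
  have hposm : ∀ n, Measurable[S.sigmaOf {.pos}] (S.pos n) := fun n =>
    measurable_pos_sigmaOf (mem_singleton _) n
  have hmarkm : ∀ n, Measurable[S.sigmaOf (markSource n)] (S.mark n) := fun n =>
    measurable_mark_sigmaOf Subset.rfl
  have hmarks : ∫⁻ ω, expNeg (∑' n, ψ (S.pos n ω, S.mark n ω)) ∂P
      = ∫⁻ ω, expNeg (∑' n, f (S.pos n ω)) ∂P :=
    lintegral_expNeg_tsum_marks (fun n => hS.sigmaOf_le (markSource n))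
      (fun n => hS.sigmaOf_le (markSource n)ᶜ) h₀ hlt hind hposm hmarkm hψ hf
      (fun n x => (hG n x).trans (hfL x).symm)
  have : SigmaFinite (ENNReal.ofReal mu • (volume : Measure Plane)) :=
    inferInstanceAs (SigmaFinite (mu.toNNReal • (volume : Measure Plane)))
  have hint : ∫⁻ x, L x ∂(ENNReal.ofReal mu • (volume : Measure Plane))
      = ENNReal.ofReal (2 * δ * (mu / lam) / nZ * K) := by
    have hpi := Real.pi_pos
    have hswap : ∫⁻ x : Plane, ∫⁻ ω, ENNReal.ofReal
          (interferenceLoss θ η (S.servDist 0 ω) ‖x‖) ∂P ∂volume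
        = ENNReal.ofReal (2 * Real.pi * K) * ENNReal.ofReal (1 / (lam * Real.pi)) := by
      -- By Tonelli the plane is integrated first, leaving a multiple of the squared service
      -- distance, whose mean is known.
      rw [lintegral_lintegral_swap hloss.aemeasurable,
        ← hS.bs_ppp.lintegral_sq_nearestDist hlam 0 (hS.law_servDist 0),
        ← lintegral_const_mul _ ((hS.measurable_servDist 0).pow_const 2).ennreal_ofReal]
      refine lintegral_congr_ae ?_
      filter_upwards [hS.ae_servDist_nonneg 0] with ω hω
      exact lintegral_interferenceLoss hθ hη hω
    rw [lintegral_smul_measure, lintegral_const_mul _ (hloss.lintegral_prod_right'.const_mul _),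
      lintegral_const_mul _ hloss.lintegral_prod_right', hswap, smul_eq_mul,
      ← ENNReal.ofReal_natCast, ← ENNReal.ofReal_inv_of_pos hn,
      ← ENNReal.ofReal_mul (by positivity), ← ENNReal.ofReal_mul (by positivity),
      ← ENNReal.ofReal_mul hδ.le, ← ENNReal.ofReal_mul hmu.le]
    congr 1
    field_simp
  calc ∫⁻ ω, expNeg (a * S.interInterference z ρ η ω) ∂P
      = ∫⁻ ω, expNeg (∑' n, ψ (S.pos n ω, S.mark n ω)) ∂P := by
        simp_rw [interInterference_eq_tsum, ← ENNReal.tsum_mul_left, ψ]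
    _ = expNeg (∫⁻ x, (1 - expNeg (f x)) ∂(ENNReal.ofReal mu • (volume : Measure Plane))) := by
        rw [hmarks, IsPoissonProcess.lintegral_expNeg_tsum hS.pos_ppp hf]
    _ = expNeg (∫⁻ x, L x ∂(ENNReal.ofReal mu • (volume : Measure Plane))) := by
        congr 1
        refine lintegral_congr fun x => ?_
        rw [hfL, ENNReal.sub_sub_cancel ENNReal.one_ne_top (hL1 x)]
    _ = _ := by rw [hint, expNeg_ofReal (by positivity)]

/-- The success probability is the Laplace transform of noise plus interference. -/
lemma measure_success [IsProbabilityMeasure P] (hS : S.IsRBC P bs Q lam mu δ) {ρ θ η σ : ℝ}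
    (hρ : 0 < ρ) (hθ : 0 < θ) (z : Fin nZ) :
    P {ω | ENNReal.ofReal θ < S.sinr z ρ η σ ω} =
      ENNReal.ofReal (Real.exp (-(σ ^ 2 * θ / ρ))) *
        ((∫⁻ ω, expNeg (ENNReal.ofReal (θ / ρ) * S.intraInterference ρ ω) ∂P) *
          ∫⁻ ω, expNeg (ENNReal.ofReal (θ / ρ) * S.interInterference z ρ η ω) ∂P) := by
  set D : Ω → ENNReal := fun ω => ENNReal.ofReal θ *
    (ENNReal.ofReal (σ ^ 2) + S.intraInterference ρ ω + S.interInterference z ρ η ω)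
  have hevent : {ω | ENNReal.ofReal θ < S.sinr z ρ η σ ω}
      = {ω | D ω < ENNReal.ofReal (ρ * S.testGain ω)} := by
    ext ω
    have h0 : ENNReal.ofReal θ ≠ 0 := by simpa using hθ
    simp only [mem_ofPred_eq, sinr, D]
    -- Since the threshold is neither `0` nor `⊤`, this is valid even if the denominator is `0` or
    -- `⊤`.
    rw [ENNReal.lt_div_iff_mul_lt (Or.inr ENNReal.ofReal_ne_top) (Or.inr h0)]
  have hDi : intraSource ⊆ {RandomSource.testGain}ᶜ := by
    simp [intraSource]
  have hDo : interSource ⊆ {RandomSource.testGain}ᶜ := by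
    simp [interSource, markSource]
  have hD : Measurable[S.sigmaOf {RandomSource.testGain}ᶜ] D :=
    (((measurable_intraInterference_sigmaOf hDi ρ).const_add _).fun_add
      (measurable_interInterference_sigmaOf hDo z ρ η)).const_mul _
  have hDm : Measurable D := hD.mono (hS.sigmaOf_le _) le_rfl
  have hset : MeasurableSet {p : ENNReal × ℝ | p.1 < ENNReal.ofReal (ρ * p.2)} :=
    measurableSet_lt measurable_fst (by fun_prop)
  have hmeasE : MeasurableSet {ω | D ω < ENNReal.ofReal (ρ * S.testGain ω)} :=
    (hDm.prodMk hS.measurable_testGain) hset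
  have hind : Indep (S.sigmaOf {RandomSource.testGain}ᶜ) (S.sigmaOf {RandomSource.testGain}) P :=
    hS.indep_sigmaOf disjoint_compl_left
  have hT : Measurable[S.sigmaOf {RandomSource.testGain}] S.testGain :=
    measurable_testGain_sigmaOf (mem_singleton _)
  have hF : Measurable (indicator {p : ENNReal × ℝ | p.1 < ENNReal.ofReal (ρ * p.2)}
      fun _ => (1 : ENNReal)) := measurable_const.indicator hset
  have h1 := lintegral_eq_lintegral_lintegral_of_indep (hS.sigmaOf_le _) (hS.sigmaOf_le _)
    hind hD hT hF
  have hl : ∫⁻ ω, indicator {p : ENNReal × ℝ | p.1 < ENNReal.ofReal (ρ * p.2)}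
      (fun _ => (1 : ENNReal)) (D ω, S.testGain ω) ∂P
      = P {ω | D ω < ENNReal.ofReal (ρ * S.testGain ω)} := by
    rw [← lintegral_indicator_one hmeasE]; rfl
  have hr : ∀ y : ENNReal, ∫⁻ ω, indicator {p : ENNReal × ℝ | p.1 < ENNReal.ofReal (ρ * p.2)}
      (fun _ => (1 : ENNReal)) (y, S.testGain ω) ∂P = expNeg (ENNReal.ofReal (1 / ρ) * y) := by
    intro y
    have hy : MeasurableSet {h : ℝ | y < ENNReal.ofReal (ρ * h)} :=
      measurableSet_lt measurable_const (by fun_prop)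
    rw [← expMeasure_lt_ofReal hρ, ← hS.law_testGain,
      Measure.map_apply hS.measurable_testGain hy,
      ← lintegral_indicator_one (hS.measurable_testGain hy)]
    rfl
  rw [hevent, ← hl, h1]
  simp_rw [hr]
  have hsplit : ∀ ω, expNeg (ENNReal.ofReal (1 / ρ) * D ω) =
      ENNReal.ofReal (Real.exp (-(σ ^ 2 * θ / ρ))) *
        (expNeg (ENNReal.ofReal (θ / ρ) * S.intraInterference ρ ω) *
          expNeg (ENNReal.ofReal (θ / ρ) * S.interInterference z ρ η ω)) := by
    intro ω
    have ha : ENNReal.ofReal (1 / ρ) * ENNReal.ofReal θ = ENNReal.ofReal (θ / ρ) := by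
      rw [← ENNReal.ofReal_mul (by positivity)]; congr 1; ring
    rw [← mul_assoc, ha, mul_add, mul_add, expNeg_add, expNeg_add,
      ← ENNReal.ofReal_mul (by positivity), expNeg_ofReal (by positivity), mul_assoc]
    congr 4; ring
  simp_rw [hsplit]
  have hIn : Measurable[S.sigmaOf intraSource]
      fun ω => expNeg (ENNReal.ofReal (θ / ρ) * S.intraInterference ρ ω) :=
    measurable_expNeg.comp ((measurable_intraInterference_sigmaOf Subset.rfl ρ).const_mul _)
  have hOut : Measurable[S.sigmaOf interSource]
      fun ω => expNeg (ENNReal.ofReal (θ / ρ) * S.interInterference z ρ η ω) :=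
    measurable_expNeg.comp ((measurable_interInterference_sigmaOf Subset.rfl z ρ η).const_mul _)
  have hdisj : Disjoint intraSource interSource := by
    refine Set.disjoint_left.2 ?_
    rintro _ (rfl | ⟨i, rfl⟩) h <;> simp [interSource, markSource] at h
  rw [lintegral_const_mul _ ((hIn.mono (hS.sigmaOf_le _) le_rfl).fun_mul
      (hOut.mono (hS.sigmaOf_le _) le_rfl)),
    lintegral_mul_eq_lintegral_mul_lintegral_of_independent_measurableSpace (hS.sigmaOf_le _)
      (hS.sigmaOf_le _) (hS.indep_sigmaOf hdisj) hIn hOut]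

lemma successProb_eq [IsProbabilityMeasure P] (hS : S.IsRBC P bs Q lam mu δ) {ρ θ η σ : ℝ}
    (hρ : 0 < ρ) (hθ : 0 < θ) (hη : 2 < η) (hlam : 0 < lam) (hmu : 0 < mu) (hδ : 0 < δ)
    (z : Fin nZ) :
    S.successProb P z ρ η σ θ =
      Real.exp (-(σ ^ 2 * θ / ρ) - 2 * δ * (mu / lam) / nZ *
        ∫ u in Ioi (1 : ℝ), θ * u ^ (1 - η) / (1 + θ * u ^ (-η))) /
        (1 + δ * (mu / lam) * θ / (nZ * (1 + θ) * 3.575)) ^ (3.575 : ℝ) := by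
  have hn : (0 : ℝ) < nZ := by exact_mod_cast (Nat.zero_le _).trans_lt z.isLt
  have hden : 1 + δ * mu / nZ * (1 - 1 / (1 + θ)) / (lam * voronoiConst)
      = 1 + δ * (mu / lam) * θ / (nZ * (1 + θ) * 3.575) := by
    unfold voronoiConst
    field_simp
    ring
  rw [successProb, measureReal_def, hS.measure_success hρ hθ z,
    hS.lintegral_expNeg_intraInterference hρ hθ hlam (by positivity),
    hS.lintegral_expNeg_interInterference hρ hθ hη hlam hmu hδ z, hden,
    show voronoiConst = 3.575 from rfl, ENNReal.toReal_mul, ENNReal.toReal_mul,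
    ENNReal.toReal_ofReal (by positivity), ENNReal.toReal_ofReal (by positivity),
    ENNReal.toReal_ofReal (by positivity), sub_eq_add_neg (-(σ ^ 2 * θ / ρ)), Real.exp_add]
  ring

end IsRBC

end RandomAccess

end

/-! ### The closed forms of the success probability. -/

theorem theorem1 {Ω Ω' : Type*} [MeasurableSpace Ω] [MeasurableSpace Ω']
    (P : Measure Ω) [IsProbabilityMeasure P] (Q : Measure Ω') [IsProbabilityMeasure Q]
    (lam mu δ ρ θ η σ α : ℝ) (nZ : ℕ)
    (hlam : 0 < lam) (hmu : 0 < mu) (hδ : 0 < δ) (hδ1 : δ ≤ 1) (hρ : 0 < ρ) (hθ : 0 < θ)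
    (hη : 2 < η) (hα : α = mu / lam)
    (bs : ℕ → Ω' → Plane) (S : RandomAccess Ω nZ) (hS : S.IsRBC P bs Q lam mu δ)
    (z : Fin nZ) :
    S.successProb P z ρ η σ θ =
        Real.exp (-(σ ^ 2 * θ / ρ) - 2 * δ * α * θ / (nZ * (η - 2)) *
            gaussHypergeometric 1 (1 - 2 / η) (2 - 2 / η) (-θ)) /
          (1 + δ * α * θ / (nZ * (1 + θ) * 3.575)) ^ (3.575 : ℝ) ∧
      (η = 4 → S.successProb P z ρ η σ θ =
        Real.exp (-(σ ^ 2 * θ / ρ) - δ * α / nZ * √θ * Real.arctan √θ) /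
          (1 + δ * α * θ / (nZ * (1 + θ) * 3.575)) ^ (3.575 : ℝ)) := by
  subst hα
  have h := hS.successProb_eq (σ := σ) hρ hθ hη hlam hmu hδ z
  constructor
  · rw [h, integral_interference_kernel hθ hη]
    have hη' : η - 2 ≠ 0 := by linarith
    congr 3
    field_simp
  · rintro rfl
    rw [h, integral_interference_kernel_four hθ]
    congr 3
    ring
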